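/- **Definitions.** Write $\overline{\mathbb N}=\{0,1,2,\dots,\infty\}$. In a partially ordered set, $x\ll y$ means: whenever $(z_n)_n$ is an increasing sequence that has a supremum with $y\le\sup_n z_n$, there is $n$ with $x\le z_n$. A *$\mathrm{Cu}$-semigroup* is a positively ordered commutative monoid in which (O1) increasing sequences have suprema, (O2) each element is the supremum of a $\ll$-increasing sequence, (O3) $x'\ll x$ and $y'\ll y$ imply $x'+y'\ll x+y$, (O4) $\sup_n(z_n+w_n)=\sup_n z_n+\sup_n w_n$ for increasing sequences. *$\mathrm{Cu}$-morphisms* are the monoid morphisms that preserve the order, $\ll$ and suprema of increasing sequences; this gives the category $\mathrm{Cu}$. A $\mathrm{Cu}$-semigroup is *countably-based* if it has a countable subset such that every element is the supremum of an increasing sequence in that subset. For $\mathrm{Cu}$-morphisms $\alpha,\beta\colon S\to T$ and a finite $F\subseteq S$, write $\alpha\simeq_F\beta$ if $\alpha(x')\le\beta(x)$ and $\beta(x')\le\alpha(x)$ for all $x',x\in F$ with $x'\ll x$. A subcategory $\mathfrak c\subseteq\mathrm{Cu}$ is *(Cuntz) Fraïssé* if - (JEP) for all $A_1,A_2\in\mathfrak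 c$ there is $B\in\mathfrak c$ with $\mathfrak c$-morphisms $A_1\to B$ and $A_2\to B$; - (NAP) for all $\mathfrak c$-morphisms $\alpha_k\colon A\to B_k$ ($k=1,2$) and all finite $F\subseteq A$ there are $\mathfrak c$-morphisms $\beta_k\colon B_k\to C$ with $\beta_1\alpha_1\simeq_F\beta_2\alpha_2$; - (SEP) there is a subcategory $\mathfrak s\subseteq\mathfrak c$ with countably many morphisms and countably-based objects such that every $A\in\mathfrak c$ admits a $\mathfrak c$-morphism to some $S\in\mathfrak s$, and for every $\mathfrak c$-morphism $\sigma\colon S\to A$ with $S\in\mathfrak s$ and every finite $F\subseteq S$ there are a $\mathfrak c$-morphism $\alpha\colon A\to T$ and an $\mathfrak s$-morphism $\tau\colon S\to T$ with $\alpha\sigma\simeq_F\tau$. A *Fraïssé sequence* of $\mathfrak c$ is an inductive sequence $(S_i,\sigma_{i,j})_{i\in\mathbb N}$ in $\mathfrak c$ of countably-based $\mathrm{Cu}$-semigroups such that for every $i$, every finite $F\subseteq S_i$ and every $\mathfrak c$-morphism $\alpha\colon S_i\to C$ there are $j\ge i$ and a $\mathfrak c$-morphism $\beta\colon C\to S_j$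 with $\beta\alpha\simeq_F\sigma_{i,j}$. The *completion* $\overline{\mathfrak c}$ has as objects the $\mathrm{Cu}$-limits of inductive sequences in $\mathfrak c$. A $\mathrm{Cu}$-morphism $\alpha\colon S\to T$ between such objects belongs to $\overline{\mathfrak c}$ if for every inductive sequence $(S_i,\sigma_{i,j})_i$ in $\mathfrak c$ with $\mathrm{Cu}$-limit $(S,\sigma_{i,\infty})_i$ there are an inductive sequence $(T_i,\tau_{i,j})_i$ in $\mathfrak c$ with $\mathrm{Cu}$-limit $(T,\tau_{i,\infty})_i$, a strictly increasing $\varphi\colon\mathbb N\to\mathbb N$ and $\mathfrak c$-morphisms $\alpha_i\colon S_i\to T_{\varphi(i)}$ such that for every $i$ and every finite $F\subseteq S_i$ there is $i_F\ge i$ with $$\alpha_k\sigma_{i,k}\simeq_F\tau_{\varphi(j),\varphi(k)}\alpha_j\sigma_{i,j}\ \ (k\ge j\ge i_F),$$ and likewise an index $i_F'\ge i$ with $$\alpha\sigma_{i,\infty}\simeq_F\tau_{\varphi(j),\infty}\alpha_j\sigma_{i,j}\ \ (j\ge i_F').$$ Let $\mathcal K_{2^{\mathbb N}}$ be the subcategory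 of $\mathrm{Cu}$ whose objects are the nonzero simplicial $\mathrm{Cu}$-semigroups, i.e. those isomorphic to $\overline{\mathbb N}^r$ for some $r\ge1$, and whose morphisms are the $\mathrm{Cu}$-morphisms that are order-embeddings and map the unit to the unit; the unit of $S\cong\overline{\mathbb N}^r$ is the element corresponding to $(1,\dots,1)$, which does not depend on the isomorphism. Let $\mathrm{Lsc}(2^{\mathbb N},\overline{\mathbb N})$ be the monoid of lower-semicontinuous functions from the Cantor set $2^{\mathbb N}$ to $\overline{\mathbb N}$ with pointwise addition and order. **Theorem.** The category $\mathcal K_{2^{\mathbb N}}$ is Fraïssé, and its Fraïssé limit is $\mathrm{Lsc}(2^{\mathbb N},\overline{\mathbb N})$: the latter is a $\mathrm{Cu}$-semigroup, Fraïssé sequences of $\mathcal K_{2^{\mathbb N}}$ exist, and for every Fraïssé sequence of $\mathcal K_{2^{\mathbb N}}$ there are maps that make $\mathrm{Lsc}(2^{\mathbb N},\overline{\mathbb N})$ its inductive limit, both in $\overline{\mathcal K_{2^{\mathbb N}}}$ and in $\mathrm{Cu}$. -/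

import Mathlib

open CategoryTheory CategoryTheory.Limits

namespace CuFraisse

/-! ### Abstract Cuntz semigroups -/

/-- Sequential compact containment `x ≪ y` in a partially ordered set. -/
def CompactlyBelow {P : Type*} [PartialOrder P] (x y : P) : Prop :=
  ∀ (z : ℕ → P) (s : P), Monotone z → IsLUB (Set.range z) s → y ≤ s → ∃ n, x ≤ z n

/-- Abstract Cuntz semigroups: positively ordered commutative monoids satisfying (O1)-(O4). -/
class IsCuSemigroup (S : Type*) [AddCommMonoid S] [PartialOrder S] : Prop
    extends IsOrderedAddMonoid S where
  zero_le' : ∀ x : S, 0 ≤ x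
  /-- (O1) -/
  exists_isLUB : ∀ z : ℕ → S, Monotone z → ∃ s, IsLUB (Set.range z) s
  /-- (O2) -/
  exists_rapid : ∀ x : S, ∃ z : ℕ → S,
    (∀ n, CompactlyBelow (z n) (z (n + 1))) ∧ IsLUB (Set.range z) x
  /-- (O3) -/
  add_compactlyBelow : ∀ x' x y' y : S, CompactlyBelow x' x → CompactlyBelow y' y →
    CompactlyBelow (x' + y') (x + y)
  /-- (O4) -/
  isLUB_add : ∀ (z w : ℕ → S) (s t : S), Monotone z → Monotone w →
    IsLUB (Set.range z) s → IsLUB (Set.range w) t →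
    IsLUB (Set.range fun n => z n + w n) (s + t)

/-- Monoid morphisms preserving the order, compact containment and suprema of increasing
sequences. -/
structure CuMorphism (S T : Type*) [AddCommMonoid S] [PartialOrder S]
    [AddCommMonoid T] [PartialOrder T] extends S →+ T where
  monotone' : Monotone toFun
  map_compactlyBelow' : ∀ x y : S, CompactlyBelow x y → CompactlyBelow (toFun x) (toFun y)
  map_isLUB' : ∀ (z : ℕ → S) (s : S), Monotone z → IsLUB (Set.range z) s →
    IsLUB (Set.range fun n => toFun (z n)) (toFun s)

instance {S T : Type*} [AddCommMonoid S] [PartialOrder S] [AddCommMonoid T] [PartialOrder T] :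
    FunLike (CuMorphism S T) S T where
  coe f := f.toFun
  coe_injective f g h := by
    cases f; cases g; congr; exact DFunLike.coe_injective h

/-- The identity morphism. -/
def CuMorphism.id (S : Type*) [AddCommMonoid S] [PartialOrder S] : CuMorphism S S where
  toAddMonoidHom := AddMonoidHom.id S
  monotone' := monotone_id
  map_compactlyBelow' _ _ h := h
  map_isLUB' _ _ _ h := h

/-- The composition `g ∘ f`. -/
def CuMorphism.comp {S T U : Type*} [AddCommMonoid S] [PartialOrder S] [AddCommMonoid T]
    [PartialOrder T] [AddCommMonoid U] [PartialOrder U]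
    (g : CuMorphism T U) (f : CuMorphism S T) : CuMorphism S U where
  toAddMonoidHom := g.toAddMonoidHom.comp f.toAddMonoidHom
  monotone' := g.monotone'.comp f.monotone'
  map_compactlyBelow' _ _ h := g.map_compactlyBelow' _ _ (f.map_compactlyBelow' _ _ h)
  map_isLUB' z _ hz h :=
    g.map_isLUB' (fun n => f.toFun (z n)) _ (fun _ _ hab => f.monotone' (hz hab))
      (f.map_isLUB' z _ hz h)

/-- The objects of the category `Cu`. -/
structure CuSem : Type 1 where
  carrier : Type
  [addCommMonoid : AddCommMonoid carrier]
  [partialOrder : PartialOrder carrier]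
  [isCuSemigroup : IsCuSemigroup carrier]

attribute [instance] CuSem.addCommMonoid CuSem.partialOrder CuSem.isCuSemigroup

instance : CoeSort CuSem Type := ⟨CuSem.carrier⟩

/-- The category `Cu`. -/
instance : Category CuSem where
  Hom S T := CuMorphism S T
  id S := CuMorphism.id S
  comp f g := CuMorphism.comp g f

instance : ConcreteCategory CuSem (fun S T => CuMorphism S T) where
  hom f := f
  ofHom f := f

/-- A semigroup is countably-based if it has a countable subset such that each element is the
supremum of an increasing sequence in that subset. -/
def IsCountablyBased (S : CuSem) : Prop :=
  ∃ B : Set S, B.Countable ∧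
    ∀ x : S, ∃ z : ℕ → S, Monotone z ∧ (∀ n, z n ∈ B) ∧ IsLUB (Set.range z) x

/-- Finite-set comparison: `f ≃_A g`. -/
def CompareOn {S T : CuSem} (A : Finset S) (f g : S ⟶ T) : Prop :=
  ∀ x' ∈ A, ∀ x ∈ A, CompactlyBelow x' x → f x' ≤ g x ∧ g x' ≤ f x

/-! ### Subcategories, sequences and the completion -/

/-- A class of objects and a class of morphisms of `Cu`. -/
structure CuClass where
  Obj : CuSem → Prop
  Hom : ∀ {S T : CuSem}, (S ⟶ T) → Prop

/-- A subcategory of `Cu`. -/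
structure CuSubcategory extends CuClass where
  source_mem : ∀ {S T : CuSem} {f : S ⟶ T}, Hom f → Obj S
  target_mem : ∀ {S T : CuSem} {f : S ⟶ T}, Hom f → Obj T
  id_mem : ∀ {S : CuSem}, Obj S → Hom (𝟙 S)
  comp_mem : ∀ {S T U : CuSem} {f : S ⟶ T} {g : T ⟶ U}, Hom f → Hom g → Hom (f ≫ g)

/-- The inductive sequence `F` lies in the class `c`. -/
def CuClass.HasSequence (c : CuClass) (F : ℕ ⥤ CuSem) : Prop :=
  (∀ i, c.Obj (F.obj i)) ∧ ∀ (i j : ℕ) (h : i ≤ j), c.Hom (F.map (homOfLE h))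

/-- `S` with the maps `ι` is the limit (in `Cu`) of the inductive sequence `F`. -/
def IsCuLimit (F : ℕ ⥤ CuSem) (S : CuSem) (ι : F ⟶ (Functor.const ℕ).obj S) : Prop :=
  Nonempty (IsColimit (Cocone.mk S ι))

/-- `S` with the maps `ι` is the limit of the inductive sequence `F` inside the class `d`: the
universal property of an inductive limit with all objects and morphisms taken in `d`. -/
def CuClass.IsLimit (d : CuClass) (F : ℕ ⥤ CuSem) (S : CuSem)
    (ι : F ⟶ (Functor.const ℕ).obj S) : Prop :=
  d.Obj S ∧ (∀ i, d.Hom (ι.app i)) ∧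
    ∀ (D : CuSem) (κ : F ⟶ (Functor.const ℕ).obj D), d.Obj D → (∀ i, d.Hom (κ.app i)) →
      ∃! f : S ⟶ D, d.Hom f ∧ ∀ i, ι.app i ≫ f = κ.app i

/-- `(α i : F i ⟶ G (φ i))` is a one-sided approximate intertwining. -/
def IsOneSidedIntertwining (F G : ℕ ⥤ CuSem) (φ : ℕ → ℕ) (hφ : StrictMono φ)
    (α : ∀ i, F.obj i ⟶ G.obj (φ i)) : Prop :=
  ∀ (i : ℕ) (A : Finset (F.obj i)), ∃ iA, i ≤ iA ∧
    ∀ (j k : ℕ) (hij : i ≤ j) (hjk : j ≤ k), iA ≤ j →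
      CompareOn A (F.map (homOfLE (hij.trans hjk)) ≫ α k)
        (F.map (homOfLE hij) ≫ α j ≫ G.map (homOfLE (hφ.monotone hjk)))

/-- The family `α` induces the morphism `f` between the limits of `F` and `G`. -/
def Induces {F G : ℕ ⥤ CuSem} {S T : CuSem} (ι : F ⟶ (Functor.const ℕ).obj S)
    (κ : G ⟶ (Functor.const ℕ).obj T) {φ : ℕ → ℕ} (α : ∀ i, F.obj i ⟶ G.obj (φ i))
    (f : S ⟶ T) : Prop :=
  ∀ (i : ℕ) (A : Finset (F.obj i)), ∃ iA, i ≤ iA ∧ ∀ (j : ℕ) (hij : i ≤ j), iA ≤ j →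
    CompareOn A ((ι.app i : F.obj i ⟶ S) ≫ f)
      (F.map (homOfLE hij) ≫ α j ≫ (κ.app (φ j) : G.obj (φ j) ⟶ T))

/-- The objects of the completion: limits in `Cu` of inductive sequences in `c`. -/
def CuClass.CompletionObj (c : CuClass) (S : CuSem) : Prop :=
  ∃ (F : ℕ ⥤ CuSem) (ι : F ⟶ (Functor.const ℕ).obj S), c.HasSequence F ∧ IsCuLimit F S ι

/-- The completion of `c`. Its morphisms are those `f : S ⟶ T` such that, for every inductive
sequence in `c` with limit `S`, there are an inductive sequence in `c` with limit `T` and a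
one-sided approximate intertwining in `c` between the two sequences that induces `f`. -/
def CuClass.completion (c : CuClass) : CuClass where
  Obj := c.CompletionObj
  Hom {S T} f := c.CompletionObj S ∧ c.CompletionObj T ∧
    ∀ (F : ℕ ⥤ CuSem) (ι : F ⟶ (Functor.const ℕ).obj S), c.HasSequence F → IsCuLimit F S ι →
      ∃ (G : ℕ ⥤ CuSem) (κ : G ⟶ (Functor.const ℕ).obj T) (φ : ℕ → ℕ) (hφ : StrictMono φ)
        (α : ∀ i, F.obj i ⟶ G.obj (φ i)),
        c.HasSequence G ∧ IsCuLimit G T κ ∧ (∀ i, c.Hom (α i)) ∧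
          IsOneSidedIntertwining F G φ hφ α ∧ Induces ι κ α f

/-! ### Fraïssé categories and Fraïssé limits -/

/-- The (Cuntz) joint embedding property. -/
def CuSubcategory.JEP (c : CuSubcategory) : Prop :=
  ∀ A₁ A₂ : CuSem, c.Obj A₁ → c.Obj A₂ →
    ∃ B : CuSem, c.Obj B ∧ (∃ f : A₁ ⟶ B, c.Hom f) ∧ ∃ g : A₂ ⟶ B, c.Hom g

/-- The (Cuntz) near amalgamation property. -/
def CuSubcategory.NAP (c : CuSubcategory) : Prop :=
  ∀ (A B₁ B₂ : CuSem) (α₁ : A ⟶ B₁) (α₂ : A ⟶ B₂), c.Hom α₁ → c.Hom α₂ → ∀ E : Finset A,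
    ∃ (C : CuSem) (β₁ : B₁ ⟶ C) (β₂ : B₂ ⟶ C), c.Hom β₁ ∧ c.Hom β₂ ∧
      CompareOn E (α₁ ≫ β₁) (α₂ ≫ β₂)

/-- (Cuntz) separability: there is a countable dominating subcategory `s`. -/
def CuSubcategory.SEP (c : CuSubcategory) : Prop :=
  ∃ s : CuSubcategory,
    (∀ S : CuSem, s.Obj S → c.Obj S) ∧
    (∀ (S T : CuSem) (f : S ⟶ T), s.Hom f → c.Hom f) ∧
    (∀ S : CuSem, s.Obj S → IsCountablyBased S) ∧
    {p : Σ S T : CuSem, S ⟶ T | s.Hom p.2.2}.Countable ∧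
    (∀ A : CuSem, c.Obj A → ∃ S : CuSem, s.Obj S ∧ ∃ f : A ⟶ S, c.Hom f) ∧
    ∀ (S A : CuSem) (σ : S ⟶ A), s.Obj S → c.Hom σ → ∀ E : Finset S,
      ∃ (T : CuSem) (α : A ⟶ T) (τ : S ⟶ T), s.Obj T ∧ c.Hom α ∧ s.Hom τ ∧
        CompareOn E (σ ≫ α) τ

/-- (Cuntz) Fraïssé categories. -/
def CuSubcategory.IsFraisse (c : CuSubcategory) : Prop :=
  c.JEP ∧ c.NAP ∧ c.SEP

/-- (Cuntz) Fraïssé sequences of `c`. -/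
def CuSubcategory.IsFraisseSequence (c : CuSubcategory) (F : ℕ ⥤ CuSem) : Prop :=
  c.HasSequence F ∧ (∀ i, IsCountablyBased (F.obj i)) ∧
    ∀ (i : ℕ) (E : Finset (F.obj i)) (C : CuSem) (α : F.obj i ⟶ C), c.Hom α →
      ∃ (j : ℕ) (hij : i ≤ j) (β : C ⟶ F.obj j), c.Hom β ∧
        CompareOn E (α ≫ β) (F.map (homOfLE hij))

/-- `S` is the Fraïssé limit of `c`: there is a Fraïssé sequence of `c`, and `S` is the limit of
every such sequence, both in the completion of `c` and in `Cu`. -/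
def CuSubcategory.IsFraisseLimit (c : CuSubcategory) (S : CuSem) : Prop :=
  (∃ F : ℕ ⥤ CuSem, c.IsFraisseSequence F) ∧
    ∀ F : ℕ ⥤ CuSem, c.IsFraisseSequence F →
      ∃ ι : F ⟶ (Functor.const ℕ).obj S, c.completion.IsLimit F S ι ∧ IsCuLimit F S ι

/-! ### Simplicial semigroups and the category of the Cantor set -/

/-- `S` is a nonzero simplicial semigroup: `S ≅ ℕ∞ ^ r` for some `r ≥ 1`. All of the structure of
`Cu` is determined by addition and order, so isomorphisms are additive order isomorphisms. -/
def IsSimplicial (S : CuSem) : Prop :=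
  ∃ r : ℕ, 1 ≤ r ∧ Nonempty (S ≃+o (Fin r → ℕ∞))

/-- `u` corresponds to `(1, …, 1)` under some isomorphism `S ≅ ℕ∞ ^ r`. -/
def IsSimplicialUnit (S : CuSem) (u : S) : Prop :=
  ∃ (r : ℕ) (e : S ≃+o (Fin r → ℕ∞)), e u = 1

/-- The unit of a simplicial semigroup does not depend on the chosen isomorphism: it is the least
upper bound of the minimal nonzero elements. -/
theorem IsSimplicialUnit.isLUB {S : CuSem} {u : S} (h : IsSimplicialUnit S u) :
    IsLUB {a : S | a ≠ 0 ∧ ∀ b ≤ a, b = 0 ∨ b = a} u := by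
  classical
  obtain ⟨r, e, he⟩ := h
  have hle : ∀ x y : S, e x ≤ e y ↔ x ≤ y := fun x y => map_le_map_iff e
  have h0 : e 0 = 0 := map_zero e
  constructor
  · rintro a ⟨ha, hmin⟩
    rw [← hle, he]
    intro i
    by_contra hi
    obtain ⟨b, hb⟩ := EquivLike.surjective e (Pi.single i 1)
    have hba : b ≤ a := by
      rw [← hle, hb]
      intro j
      by_cases hj : j = i
      · subst hj
        simpa using (not_le.mp hi).le
      · simp [hj]
    rcases hmin b hba with h | h
    · rw [h, h0] at hb
      simpa using congrFun hb i
    · rw [← h, hb] at hi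
      simp at hi
  · intro v hv
    rw [← hle, he]
    intro i
    obtain ⟨b, hb⟩ := EquivLike.surjective e (Pi.single i 1)
    have hbv : b ≤ v := by
      refine hv ⟨?_, ?_⟩
      · rintro rfl
        rw [h0] at hb
        simpa using congrFun hb i
      · intro c hc
        rw [← hle, hb] at hc
        have hoff : ∀ j, j ≠ i → e c j = 0 := fun j hj => by
          simpa [hj] using hc j
        have hon : e c i ≤ 1 := by simpa using hc i
        rcases Order.le_one_iff.mp hon with h | h
        · left
          apply EquivLike.injective e
          rw [h0]
          funext j
          by_cases hj : j = i
          · subst hj; exact h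
          · exact hoff j hj
        · right
          apply EquivLike.injective e
          rw [hb]
          funext j
          by_cases hj : j = i
          · subst hj; simpa using h
          · simpa [hj] using hoff j hj
    have := (hle _ _).mpr hbv i
    rw [hb] at this
    simpa using this

theorem IsSimplicialUnit.eq {S : CuSem} {u v : S} (hu : IsSimplicialUnit S u)
    (hv : IsSimplicialUnit S v) : u = v :=
  hu.isLUB.unique hv.isLUB

/-- The category whose objects are the nonzero simplicial semigroups and whose morphisms are the
order-embeddings (in `Cu`) that map the unit to the unit. -/
def cantorCategory : CuSubcategory where
  Obj := IsSimplicial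
  Hom {S T} f := IsSimplicial S ∧ IsSimplicial T ∧ (∀ x y : S, f x ≤ f y ↔ x ≤ y) ∧
    ∀ u : S, IsSimplicialUnit S u → IsSimplicialUnit T (f u)
  source_mem h := h.1
  target_mem h := h.2.1
  id_mem h := ⟨h, h, fun _ _ => Iff.rfl, fun _ hu => hu⟩
  comp_mem hf hg := ⟨hf.1, hg.2.1,
    fun x y => (hg.2.2.1 _ _).trans (hf.2.2.1 x y), fun u hu => hg.2.2.2 _ (hf.2.2.2 u hu)⟩

/-! ### Lower-semicontinuous functions -/

/-- `Lsc(X, ℕ∞)`, with pointwise addition and order. -/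
def Lsc (X : Type*) [TopologicalSpace X] : AddSubmonoid (X → ℕ∞) where
  carrier := {f | LowerSemicontinuous f}
  zero_mem' := lowerSemicontinuous_const
  add_mem' hf hg := hf.add hg

end CuFraisse

/-! The category is dual to finite nonempty sets with surjections. A morphism between powers of `ℕ∞`
that preserves the unit sends the generators to a partition of the unit, so in each target
coordinate exactly one generator takes the value `1`. The morphism is therefore composition with a
map of index sets (`exists_dual`), and being an order-embedding makes this map surjective. Joint
embedding and amalgamation are then products and fibre products, and separability holds because
there are countably many maps between standard finite sets.

Everything is algebraic, i.e. generated by compact elements. On compact elements the relation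
`CompareOn` is equality, so a Fraïssé sequence is dual to an inverse sequence of finite sets with an
exact extension property. A back-and-forth argument (`exists_cantor_surjections`) presents these
sets as quotients of the Cantor set that jointly separate points. Functions factoring through the
quotients approximate every lower-semicontinuous function from below, and a cocone of embeddings
with dense compact images is a limit (`isCuLimit_of_dense`), so `Lsc` is the limit in `Cu`.

For the completion, its morphisms turn out to be the order-embeddings preserving an intrinsically
defined unit (`IsUnitalEmbedding.of_completion_hom`, `IsUnitalEmbedding.completion_hom`). The
mediating map of a cocone of such embeddings is again one, so limits in `Cu` are limits in the
completion. -/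

namespace CuFraisse

/-! ### Compact elements and compact bases -/

section Order

variable {P : Type*} [PartialOrder P]

theorem CompactlyBelow.trans_le {x y z : P} (h : CompactlyBelow x y) (hyz : y ≤ z) :
    CompactlyBelow x z :=
  fun w s hw hs hzs => h w s hw hs (hyz.trans hzs)

theorem CompactlyBelow.le_trans {x y z : P} (hxy : x ≤ y) (h : CompactlyBelow y z) :
    CompactlyBelow x z :=
  fun w s hw hs hzs => (h w s hw hs hzs).imp fun _ hn => hxy.trans hn

theorem isLUB_range_const (x : P) : IsLUB (Set.range fun _ : ℕ => x) x := by
  rw [Set.range_const]; exact isLUB_singleton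

theorem CompactlyBelow.le {x y : P} (h : CompactlyBelow x y) : x ≤ y := by
  obtain ⟨_, hn⟩ := h (fun _ => y) y monotone_const (isLUB_range_const y) le_rfl
  exact hn

theorem eq_of_compact_of_isLUB {t : P} (ht : CompactlyBelow t t) {z : ℕ → P} (hz : Monotone z)
    (hs : IsLUB (Set.range z) t) : ∃ n, t = z n := by
  obtain ⟨n, hn⟩ := ht z t hz hs le_rfl
  exact ⟨n, hn.antisymm (hs.1 ⟨n, rfl⟩)⟩

/-- Each element is the supremum of an increasing sequence in `K`. -/
def SeqDense (K : Set P) : Prop :=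
  ∀ x : P, ∃ z : ℕ → P, Monotone z ∧ (∀ n, z n ∈ K) ∧ IsLUB (Set.range z) x

theorem SeqDense.mem_of_compact {K : Set P} (hK : SeqDense K) {t : P} (ht : CompactlyBelow t t) :
    t ∈ K := by
  obtain ⟨z, hz, hzK, hs⟩ := hK t
  obtain ⟨n, rfl⟩ := eq_of_compact_of_isLUB ht hz hs
  exact hzK n

/-- A dense set of compact elements detects compact containment. -/
theorem SeqDense.exists_between {K : Set P} (hK : SeqDense K) {x y : P} (h : CompactlyBelow x y) :
    ∃ k ∈ K, x ≤ k ∧ k ≤ y := by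
  obtain ⟨z, hz, hzK, hs⟩ := hK y
  obtain ⟨n, hn⟩ := h z y hz hs le_rfl
  exact ⟨z n, hzK n, hn, hs.1 ⟨n, rfl⟩⟩

/-- A countable directed family of compact elements can be replaced by an increasing sequence;
hence suprema of increasing sequences of such suprema are again such suprema. -/
theorem exists_monotone_isLUB_of_isLUB {K : Set P} (hK : ∀ k ∈ K, CompactlyBelow k k)
    {x : ℕ → P} (hx : Monotone x) {s : P} (hs : IsLUB (Set.range x) s)
    (h : ∀ k, ∃ z : ℕ → P, Monotone z ∧ (∀ n, z n ∈ K) ∧ IsLUB (Set.range z) (x k)) :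
    ∃ z : ℕ → P, Monotone z ∧ (∀ n, z n ∈ K) ∧ IsLUB (Set.range z) s := by
  choose c hcm hcK hc using h
  let d : ℕ × ℕ → P := fun p => c p.1 p.2
  have hle : ∀ p, d p ≤ x p.1 := fun p => (hc p.1).1 ⟨p.2, rfl⟩
  have hd : Directed (· ≤ ·) d := by
    rintro p q
    -- Both elements lie below the supremum of row `max p.1 q.1`, so compactness puts each below an
    -- entry of that row.
    have hp := (hle p).trans (hx (le_max_left p.1 q.1))
    have hq := (hle q).trans (hx (le_max_right p.1 q.1))
    obtain ⟨m, hm⟩ := hK _ (hcK p.1 p.2) _ _ (hcm _) (hc _) hp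
    obtain ⟨n, hn⟩ := hK _ (hcK q.1 q.2) _ _ (hcm _) (hc _) hq
    exact ⟨(max p.1 q.1, max m n), hm.trans (hcm _ (le_max_left _ _)),
      hn.trans (hcm _ (le_max_right _ _))⟩
  refine ⟨_, hd.sequence_mono, fun n => hcK _ _, ?_, ?_⟩
  · rintro _ ⟨n, rfl⟩
    exact (hle _).trans (hs.1 ⟨_, rfl⟩)
  · intro u hu
    refine hs.2 ?_
    rintro _ ⟨k, rfl⟩
    refine (hc k).2 ?_
    rintro _ ⟨n, rfl⟩
    exact (hd.le_sequence (k, n)).trans (hu ⟨_, rfl⟩)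

end Order

/-- An algebraic ordered monoid with suprema of increasing sequences compatible with addition is a
Cuntz semigroup. -/
theorem IsCuSemigroup.of_compactBasis {P : Type*} [AddCommMonoid P] [PartialOrder P]
    [IsOrderedAddMonoid P] (h0 : ∀ x : P, 0 ≤ x)
    (hsup : ∀ z : ℕ → P, Monotone z → ∃ s, IsLUB (Set.range z) s)
    (hadd : ∀ (z w : ℕ → P) (s t : P), Monotone z → Monotone w →
      IsLUB (Set.range z) s → IsLUB (Set.range w) t →
      IsLUB (Set.range fun n => z n + w n) (s + t))
    (K : Set P) (hK : ∀ k ∈ K, CompactlyBelow k k) (hKadd : ∀ k ∈ K, ∀ l ∈ K, k + l ∈ K)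
    (hd : SeqDense K) : IsCuSemigroup P where
  zero_le' := h0
  exists_isLUB := hsup
  exists_rapid x := by
    obtain ⟨z, hz, hzK, hs⟩ := hd x
    exact ⟨z, fun n => (hK _ (hzK n)).trans_le (hz n.le_succ), hs⟩
  add_compactlyBelow x' x y' y hx hy := by
    obtain ⟨k, hk, hk1, hk2⟩ := hd.exists_between hx
    obtain ⟨l, hl, hl1, hl2⟩ := hd.exists_between hy
    exact ((hK _ (hKadd k hk l hl)).trans_le (add_le_add hk2 hl2)).le_trans (add_le_add hk1 hl1)
  isLUB_add := hadd

theorem compact_add {S : Type*} [AddCommMonoid S] [PartialOrder S] [IsCuSemigroup S] {x y : S}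
    (hx : CompactlyBelow x x) (hy : CompactlyBelow y y) : CompactlyBelow (x + y) (x + y) :=
  IsCuSemigroup.add_compactlyBelow _ _ _ _ hx hy

theorem compact_zero {S : Type*} [AddCommMonoid S] [PartialOrder S] [IsCuSemigroup S] :
    CompactlyBelow (0 : S) 0 :=
  fun _ _ _ _ _ => ⟨0, IsCuSemigroup.zero_le' _⟩

/-! ### Morphisms -/

instance {S T : Type*} [AddCommMonoid S] [PartialOrder S] [AddCommMonoid T] [PartialOrder T] :
    AddMonoidHomClass (CuMorphism S T) S T where
  map_add f := f.map_add'
  map_zero f := f.map_zero'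

theorem CuMorphism.mono {S T : Type*} [AddCommMonoid S] [PartialOrder S] [AddCommMonoid T]
    [PartialOrder T] (f : CuMorphism S T) {x y : S} (h : x ≤ y) : f x ≤ f y :=
  f.monotone' h

theorem CuMorphism.map_compact {S T : Type*} [AddCommMonoid S] [PartialOrder S] [AddCommMonoid T]
    [PartialOrder T] (f : CuMorphism S T) {x y : S} (h : CompactlyBelow x y) :
    CompactlyBelow (f x) (f y) :=
  f.map_compactlyBelow' _ _ h

theorem CuMorphism.map_isLUB {S T : Type*} [AddCommMonoid S] [PartialOrder S] [AddCommMonoid T]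
    [PartialOrder T] (f : CuMorphism S T) {z : ℕ → S} {s : S} (hz : Monotone z)
    (hs : IsLUB (Set.range z) s) : IsLUB (Set.range fun n => f (z n)) (f s) :=
  f.map_isLUB' _ _ hz hs

/-- Morphisms that agree on a dense set are equal. -/
theorem CuMorphism.ext_of_dense {S T : Type*} [AddCommMonoid S] [PartialOrder S] [AddCommMonoid T]
    [PartialOrder T] {f g : CuMorphism S T} {K : Set S} (hK : SeqDense K)
    (h : ∀ k ∈ K, f k = g k) : f = g := by
  refine DFunLike.ext _ _ fun x => ?_
  obtain ⟨z, hz, hzK, hs⟩ := hK x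
  have hf := f.map_isLUB hz hs
  have hg := g.map_isLUB hz hs
  simp only [h _ (hzK _)] at hf
  exact hf.unique hg

/-- A morphism that reflects the order on a dense set of compact elements is an order-embedding. -/
theorem CuMorphism.le_iff_of_dense {S T : Type*} [AddCommMonoid S] [PartialOrder S]
    [AddCommMonoid T] [PartialOrder T] (f : CuMorphism S T) {K : Set S} (hK : SeqDense K)
    (hc : ∀ k ∈ K, CompactlyBelow k k)
    (h : ∀ k ∈ K, ∀ l ∈ K, f k ≤ f l → k ≤ l) (x y : S) : f x ≤ f y ↔ x ≤ y := by
  refine ⟨fun hxy => ?_, fun hxy => f.mono hxy⟩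
  obtain ⟨z, hz, hzK, hzs⟩ := hK x
  obtain ⟨w, hw, hwK, hws⟩ := hK y
  refine hzs.2 ?_
  rintro _ ⟨n, rfl⟩
  obtain ⟨m, hm⟩ := f.map_compact (hc _ (hzK n)) _ _ (fun a b hab => f.mono (hw hab))
    (f.map_isLUB hw hws) ((f.mono (hzs.1 ⟨n, rfl⟩)).trans hxy)
  exact (h _ (hzK n) _ (hwK m) hm).trans (hws.1 ⟨m, rfl⟩)

/-- Extension of a morphism from a compact basis. -/
theorem exists_cuMorphism_extension {S D : Type*} [AddCommMonoid S] [PartialOrder S]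
    [IsCuSemigroup S] [AddCommMonoid D] [PartialOrder D] [IsCuSemigroup D]
    {K : Set S} (hK : SeqDense K) (hc : ∀ k ∈ K, CompactlyBelow k k) (hK0 : 0 ∈ K)
    (hKadd : ∀ k ∈ K, ∀ l ∈ K, k + l ∈ K) (g : S → D) (g0 : g 0 = 0)
    (gadd : ∀ k ∈ K, ∀ l ∈ K, g (k + l) = g k + g l)
    (gmono : ∀ k ∈ K, ∀ l ∈ K, k ≤ l → g k ≤ g l)
    (gc : ∀ k ∈ K, CompactlyBelow (g k) (g k)) :
    ∃ f : CuMorphism S D, ∀ k ∈ K, f k = g k := by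
  have gm : ∀ z : ℕ → S, Monotone z → (∀ n, z n ∈ K) → Monotone (fun n => g (z n)) :=
    fun z hz hzK a b hab => gmono _ (hzK a) _ (hzK b) (hz hab)
  -- Compactness interleaves approximating sequences; for `x = y` this makes the value independent
  -- of the sequence.
  have key : ∀ x y : S, x ≤ y → ∀ z w : ℕ → S, Monotone z → Monotone w → (∀ n, z n ∈ K) →
      (∀ n, w n ∈ K) → IsLUB (Set.range z) x → IsLUB (Set.range w) y → ∀ s t : D,
      IsLUB (Set.range fun n => g (z n)) s → IsLUB (Set.range fun n => g (w n)) t → s ≤ t := by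
    intro x y hxy z w hz hw hzK hwK hzx hwy s t hs ht
    refine hs.2 ?_
    rintro _ ⟨n, rfl⟩
    obtain ⟨m, hm⟩ := hc _ (hzK n) w y hw hwy ((hzx.1 ⟨n, rfl⟩).trans hxy)
    exact (gmono _ (hzK n) _ (hwK m) hm).trans (ht.1 ⟨m, rfl⟩)
  have hK' := hK
  choose z hz hzK hzx using hK
  choose f hf using fun x => IsCuSemigroup.exists_isLUB _ (gm (z x) (hz x) (hzK x))
  have hlub : ∀ (w : ℕ → S) (x : S), Monotone w → (∀ n, w n ∈ K) → IsLUB (Set.range w) x →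
      IsLUB (Set.range fun n => g (w n)) (f x) := by
    intro w x hw hwK hwx
    obtain ⟨t, ht⟩ := IsCuSemigroup.exists_isLUB _ (gm w hw hwK)
    have h1 := key x x le_rfl (z x) w (hz x) hw (hzK x) hwK (hzx x) hwx _ _ (hf x) ht
    have h2 := key x x le_rfl w (z x) hw (hz x) hwK (hzK x) hwx (hzx x) _ _ ht (hf x)
    rwa [h1.antisymm h2]
  have hfg : ∀ k ∈ K, f k = g k := fun k hk =>
    (hlub (fun _ => k) k monotone_const (fun _ => hk) (isLUB_range_const k)).unique
      (isLUB_range_const (g k))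
  have fmono : Monotone f := fun x y hxy => key x y hxy (z x) (z y) (hz x) (hz y) (hzK x) (hzK y)
    (hzx x) (hzx y) _ _ (hf x) (hf y)
  refine ⟨{ toFun := f, map_zero' := (hfg 0 hK0).trans g0, map_add' := ?_, monotone' := fmono,
            map_compactlyBelow' := ?_, map_isLUB' := ?_ }, hfg⟩
  · intro x y
    have h1 := hlub (fun n => z x n + z y n) (x + y)
      (fun a b hab => add_le_add (hz x hab) (hz y hab))
      (fun n => hKadd _ (hzK x n) _ (hzK y n))
      (IsCuSemigroup.isLUB_add _ _ _ _ (hz x) (hz y) (hzx x) (hzx y))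
    have h2 := IsCuSemigroup.isLUB_add _ _ _ _ (gm _ (hz x) (hzK x)) (gm _ (hz y) (hzK y))
      (hf x) (hf y)
    simp only [gadd _ (hzK x _) _ (hzK y _)] at h1
    exact h1.unique h2
  · intro x y hxy
    obtain ⟨k, hk, h1, h2⟩ := hK'.exists_between hxy
    have := gc k hk
    rw [← hfg k hk] at this
    exact (this.trans_le (fmono h2)).le_trans (fmono h1)
  · intro w x hw hwx
    refine ⟨?_, fun u hu => (hf x).2 ?_⟩
    · rintro _ ⟨n, rfl⟩
      exact fmono (hwx.1 ⟨n, rfl⟩)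
    · rintro _ ⟨n, rfl⟩
      obtain ⟨m, hm⟩ := hc _ (hzK x n) w x hw hwx ((hzx x).1 ⟨n, rfl⟩)
      dsimp only
      rw [← hfg _ (hzK x n)]
      exact (fmono hm).trans (hu ⟨m, rfl⟩)

/-! ### Inductive limits of algebraic semigroups -/

section Limit

variable {F : ℕ ⥤ CuSem} {S : CuSem} (ι : F ⟶ (Functor.const ℕ).obj S)

/-- The component at `i` of a cocone, as a morphism. -/
abbrev leg (i : ℕ) : F.obj i ⟶ S := ι.app i

/-- The images of the compact elements of the terms of an inductive sequence. -/
def compactImages : Set S :=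
  {x | ∃ (i : ℕ) (a : F.obj i), CompactlyBelow a a ∧ leg ι i a = x}

variable {ι}

theorem leg_map {i j : ℕ} (h : i ≤ j) (a : F.obj i) :
    leg ι j (F.map (homOfLE h) a) = leg ι i a := by
  have : F.map (homOfLE h) ≫ leg ι j = leg ι i := by
    simp
  rw [← this]; rfl

theorem compact_of_mem_compactImages {x : S} (hx : x ∈ compactImages ι) : CompactlyBelow x x := by
  obtain ⟨i, a, ha, rfl⟩ := hx
  exact CuMorphism.map_compact _ ha

/-- An element of `compactImages` comes from all sufficiently late stages. -/
theorem exists_eq_leg_of_le {x : S} (hx : x ∈ compactImages ι) :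
    ∃ i, ∀ j, i ≤ j → ∃ a : F.obj j, CompactlyBelow a a ∧ leg ι j a = x := by
  obtain ⟨i, a, ha, rfl⟩ := hx
  exact ⟨i, fun j hij => ⟨F.map (homOfLE hij) a, CuMorphism.map_compact _ ha, leg_map hij a⟩⟩

theorem exists_common_stage {x y : S} (hx : x ∈ compactImages ι) (hy : y ∈ compactImages ι) :
    ∃ (i : ℕ) (a b : F.obj i), CompactlyBelow a a ∧ CompactlyBelow b b ∧
      leg ι i a = x ∧ leg ι i b = y := by
  obtain ⟨i, hi⟩ := exists_eq_leg_of_le hx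
  obtain ⟨j, hj⟩ := exists_eq_leg_of_le hy
  obtain ⟨a, ha, hax⟩ := hi _ (le_max_left i j)
  obtain ⟨b, hb, hby⟩ := hj _ (le_max_right i j)
  exact ⟨_, a, b, ha, hb, hax, hby⟩

theorem zero_mem_compactImages : (0 : S) ∈ compactImages ι :=
  ⟨0, 0, compact_zero, map_zero _⟩

theorem add_mem_compactImages {x y : S} (hx : x ∈ compactImages ι) (hy : y ∈ compactImages ι) :
    x + y ∈ compactImages ι := by
  obtain ⟨i, a, b, ha, hb, rfl, rfl⟩ := exists_common_stage hx hy
  exact ⟨i, a + b, compact_add ha hb, map_add _ _ _⟩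

/-- A cocone of order-embeddings whose compact images are dense is a limit cocone. -/
theorem isCuLimit_of_dense (hι : ∀ i (a b : F.obj i), leg ι i a ≤ leg ι i b → a ≤ b)
    (hF : ∀ i, SeqDense {a : F.obj i | CompactlyBelow a a})
    (hd : SeqDense (compactImages ι)) : IsCuLimit F S ι := by
  classical
  have ex : ∀ (D : CuSem) (κ : F ⟶ (Functor.const ℕ).obj D),
      ∃ f : S ⟶ D, ∀ i, leg ι i ≫ f = leg κ i := by
    intro D κ
    have hle : ∀ i j (a : F.obj i) (b : F.obj j), leg ι i a ≤ leg ι j b →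
        leg κ i a ≤ leg κ j b := by
      intro i j a b h
      rw [← leg_map (ι := ι) (le_max_left i j), ← leg_map (ι := ι) (le_max_right i j) b] at h
      rw [← leg_map (ι := κ) (le_max_left i j), ← leg_map (ι := κ) (le_max_right i j) b]
      exact CuMorphism.mono _ (hι _ _ _ h)
    -- By `hle` the chosen stage and preimage are immaterial. The value `0` elsewhere is never read:
    -- the extension evaluates `g` on `compactImages ι` only.
    let g : S → D := fun x =>
      if h : x ∈ compactImages ι then leg κ h.choose h.choose_spec.choose else 0
    have hg : ∀ i (a : F.obj i), CompactlyBelow a a → g (leg ι i a) = leg κ i a := by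
      intro i a ha
      have h : leg ι i a ∈ compactImages ι := ⟨i, a, ha, rfl⟩
      have h2 := h.choose_spec.choose_spec.2
      simp only [g, dif_pos h]
      exact (hle _ _ _ _ h2.le).antisymm (hle _ _ _ _ h2.ge)
    obtain ⟨f, hf⟩ := exists_cuMorphism_extension hd (fun k hk => compact_of_mem_compactImages hk)
      zero_mem_compactImages (fun k hk l hl => add_mem_compactImages hk hl) g
      (by
        have := hg 0 0 compact_zero
        rwa [map_zero, map_zero] at this)
      (by
        intro k hk l hl
        obtain ⟨i, a, b, ha, hb, rfl, rfl⟩ := exists_common_stage hk hl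
        rw [← map_add, hg _ _ ha, hg _ _ hb, hg _ _ (compact_add ha hb), map_add])
      (by
        rintro _ ⟨i, a, ha, rfl⟩ _ ⟨j, b, hb, rfl⟩ h
        rw [hg _ _ ha, hg _ _ hb]
        exact hle _ _ _ _ h)
      (by
        rintro _ ⟨i, a, ha, rfl⟩
        rw [hg _ _ ha]
        exact CuMorphism.map_compact _ ha)
    refine ⟨f, fun i => CuMorphism.ext_of_dense (hF i) fun a ha => ?_⟩
    exact (hf _ ⟨i, a, ha, rfl⟩).trans (hg i a ha)
  refine ⟨{ desc := fun s => (ex s.pt s.ι).choose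
            fac := fun s j => (ex s.pt s.ι).choose_spec j
            uniq := fun s m hm => ?_ }⟩
  refine CuMorphism.ext_of_dense hd ?_
  rintro _ ⟨i, a, ha, rfl⟩
  have h1 : leg ι i ≫ m = leg ι i ≫ (ex s.pt s.ι).choose :=
    (hm i).trans ((ex s.pt s.ι).choose_spec i).symm
  exact congrArg (fun f : F.obj i ⟶ s.pt => f a) h1

/-- The suprema of increasing sequences of compact images. -/
def limitSubmonoid (ι : F ⟶ (Functor.const ℕ).obj S) : AddSubmonoid S where
  carrier := {x | ∃ z : ℕ → S, Monotone z ∧ (∀ n, z n ∈ compactImages ι) ∧ IsLUB (Set.range z) x}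
  zero_mem' := ⟨fun _ => 0, monotone_const, fun _ => zero_mem_compactImages, isLUB_range_const 0⟩
  add_mem' := by
    rintro x y ⟨z, hz, hzK, hzx⟩ ⟨w, hw, hwK, hwy⟩
    exact ⟨fun n => z n + w n, fun a b hab => add_le_add (hz hab) (hw hab),
      fun n => add_mem_compactImages (hzK n) (hwK n),
      IsCuSemigroup.isLUB_add _ _ _ _ hz hw hzx hwy⟩

/-- By `exists_monotone_isLUB_of_isLUB` the supremum taken in `S` stays in the submonoid. Hence the
submonoid is itself a Cu-semigroup and its inclusion is a Cu-morphism. -/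
theorem isLUB_limitSubmonoid_iff {z : ℕ → limitSubmonoid ι} (hz : Monotone z)
    {s : limitSubmonoid ι} :
    IsLUB (Set.range z) s ↔ IsLUB (Set.range fun n => (z n : S)) (s : S) := by
  have hback : ∀ t : limitSubmonoid ι, IsLUB (Set.range fun n => (z n : S)) (t : S) →
      IsLUB (Set.range z) t := by
    intro t ht
    refine ⟨?_, fun u hu => ?_⟩
    · rintro _ ⟨n, rfl⟩
      exact ht.1 ⟨n, rfl⟩
    · have hu' : (u : S) ∈ upperBounds (Set.range fun n => (z n : S)) := by
        rintro _ ⟨n, rfl⟩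
        exact hu ⟨n, rfl⟩
      exact ht.2 hu'
  refine ⟨fun hs => ?_, hback s⟩
  obtain ⟨t, ht⟩ := IsCuSemigroup.exists_isLUB (fun n => (z n : S)) hz
  have htm : t ∈ limitSubmonoid ι := exists_monotone_isLUB_of_isLUB
    (fun k hk => compact_of_mem_compactImages hk) hz ht fun k => (z k).2
  have := hs.unique (hback ⟨t, htm⟩ ht)
  rwa [this]

theorem compactlyBelow_limitSubmonoid {x y : limitSubmonoid ι}
    (h : CompactlyBelow (x : S) (y : S)) : CompactlyBelow x y :=
  fun _ _ hz hs hys => h _ _ hz ((isLUB_limitSubmonoid_iff hz).1 hs) hys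

theorem mem_limitSubmonoid_of_mem {x : S} (hx : x ∈ compactImages ι) : x ∈ limitSubmonoid ι :=
  ⟨fun _ => x, monotone_const, fun _ => hx, isLUB_range_const x⟩

theorem seqDense_limitSubmonoid :
    SeqDense {x : limitSubmonoid ι | (x : S) ∈ compactImages ι} := by
  intro x
  obtain ⟨z, hz, hzK, hzx⟩ := x.2
  exact ⟨fun n => ⟨z n, mem_limitSubmonoid_of_mem (hzK n)⟩, hz, hzK,
    (isLUB_limitSubmonoid_iff hz).2 hzx⟩

instance : IsCuSemigroup (limitSubmonoid ι) := by
  refine IsCuSemigroup.of_compactBasis (fun x => IsCuSemigroup.zero_le' (x : S)) ?_ ?_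
    {x : limitSubmonoid ι | (x : S) ∈ compactImages ι}
    (fun k hk => compactlyBelow_limitSubmonoid (compact_of_mem_compactImages hk))
    (fun k hk l hl => add_mem_compactImages hk hl) seqDense_limitSubmonoid
  · intro z hz
    obtain ⟨t, ht⟩ := IsCuSemigroup.exists_isLUB (fun n => (z n : S)) hz
    exact ⟨⟨t, exists_monotone_isLUB_of_isLUB
      (fun k hk => compact_of_mem_compactImages hk) hz ht fun k => (z k).2⟩,
      (isLUB_limitSubmonoid_iff hz).2 ht⟩
  · intro z w s t hz hw hs ht
    rw [isLUB_limitSubmonoid_iff hz] at hs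
    rw [isLUB_limitSubmonoid_iff hw] at ht
    rw [isLUB_limitSubmonoid_iff fun a b hab => add_le_add (hz hab) (hw hab)]
    exact IsCuSemigroup.isLUB_add _ _ _ _ hz hw hs ht

/-- In a limit of algebraic semigroups the compact images are dense. -/
theorem IsCuLimit.seqDense (h : IsCuLimit F S ι)
    (hF : ∀ i, SeqDense {a : F.obj i | CompactlyBelow a a}) : SeqDense (compactImages ι) := by
  obtain ⟨h⟩ := h
  let S' : CuSem := { carrier := limitSubmonoid ι }
  let incl : S' ⟶ S := CuMorphism.mk (limitSubmonoid ι).subtype (fun _ _ hab => hab)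
    (fun x y hxy => by
      obtain ⟨k, hk, h1, h2⟩ := seqDense_limitSubmonoid.exists_between hxy
      exact ((compact_of_mem_compactImages hk).trans_le h2).le_trans h1)
    (fun _ _ hz hs => (isLUB_limitSubmonoid_iff hz).1 hs)
  have hmem : ∀ i (a : F.obj i), leg ι i a ∈ limitSubmonoid ι := by
    intro i a
    obtain ⟨z, hz, hzK, hza⟩ := hF i a
    exact ⟨fun n => leg ι i (z n), fun _ _ hab => CuMorphism.mono _ (hz hab),
      fun n => ⟨i, z n, hzK n, rfl⟩, CuMorphism.map_isLUB _ hz hza⟩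
  let κ : F ⟶ (Functor.const ℕ).obj S' :=
    { app := fun i => CuMorphism.mk ((leg ι i).toAddMonoidHom.codRestrict _ (hmem i))
        (fun _ _ hab => CuMorphism.mono (leg ι i) hab)
        (fun x y hxy => compactlyBelow_limitSubmonoid (CuMorphism.map_compact (leg ι i) hxy))
        (fun _ _ hz hs => (isLUB_limitSubmonoid_iff
          (fun _ _ hab => CuMorphism.mono (leg ι i) (hz hab))).2
            (CuMorphism.map_isLUB (leg ι i) hz hs))
      naturality := fun i j f => by
        refine DFunLike.ext (F := CuMorphism _ _) _ _ fun a => Subtype.ext ?_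
        exact leg_map (ι := ι) f.le a }
  -- The legs corestrict to the submonoid, so the universal property splits its inclusion; the
  -- submonoid is all of `S`.
  have hid : h.desc (Cocone.mk S' κ) ≫ incl = 𝟙 S := by
    refine h.hom_ext fun j => ?_
    have h1 := h.fac (Cocone.mk S' κ) j
    rw [← Category.assoc, h1]
    rfl
  intro x
  have hx : incl (h.desc (Cocone.mk S' κ) x) = x :=
    congrArg (fun f : S ⟶ S => f x) hid
  have := (h.desc (Cocone.mk S' κ) x : limitSubmonoid ι).2
  rwa [show ((h.desc (Cocone.mk S' κ) x : limitSubmonoid ι) : S) = x from hx] at this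

end Limit

/-! ### Functions with values in `ℕ∞` -/

theorem isLUB_range_pi_iff {X : Type*} {z : ℕ → X → ℕ∞} {s : X → ℕ∞} :
    IsLUB (Set.range z) s ↔ ∀ x, IsLUB (Set.range fun n => z n x) (s x) := by
  rw [isLUB_pi]
  refine forall_congr' fun x => ?_
  rw [← Set.range_comp]; rfl

theorem isLUB_add_enat {z w : ℕ → ℕ∞} {s t : ℕ∞} (hz : Monotone z) (hw : Monotone w)
    (hs : IsLUB (Set.range z) s) (ht : IsLUB (Set.range w) t) :
    IsLUB (Set.range fun n => z n + w n) (s + t) := by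
  rw [← hs.iSup_eq, ← ht.iSup_eq, ENat.iSup_add_iSup_of_monotone hz hw]
  exact isLUB_iSup

theorem isLUB_min_natCast (m : ℕ∞) : IsLUB (Set.range fun n : ℕ => min m (n : ℕ∞)) m := by
  refine ⟨?_, fun u hu => ?_⟩
  · rintro _ ⟨n, rfl⟩
    exact min_le_left _ _
  · by_contra h
    rw [not_le] at h
    obtain ⟨n, hn⟩ := ENat.exists_nat_gt h.ne_top
    exact (lt_min h hn).not_ge (hu ⟨n, rfl⟩)

/-- An inequality `m + 1 ≤ s` means `m < s`, and some term already exceeds `m`. -/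
theorem enat_compact {m : ℕ∞} (hm : m ≠ ⊤) {z : ℕ → ℕ∞} {s : ℕ∞}
    (hs : IsLUB (Set.range z) s) (h : m ≤ s) : ∃ n, m ≤ z n := by
  lift m to ℕ using hm
  cases m with
  | zero => exact ⟨0, by simp⟩
  | succ m =>
    have h1 : (m : ℕ∞) < s := lt_of_lt_of_le (by exact_mod_cast m.lt_succ_self) h
    obtain ⟨_, ⟨n, rfl⟩, hn⟩ := (lt_isLUB_iff hs).1 h1
    exact ⟨n, by simpa using Order.add_one_le_of_lt hn⟩

/-- The functions with finite values. -/
def finiteValued (X : Type*) : Set (X → ℕ∞) := {a | ∀ x, a x ≠ ⊤}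

theorem compact_of_finiteValued {ι : Type*} [Finite ι] {a : ι → ℕ∞} (ha : a ∈ finiteValued ι) :
    CompactlyBelow a a := by
  intro z s hz hs has
  choose n hn using fun i => enat_compact (ha i) (isLUB_range_pi_iff.1 hs i) (has i)
  obtain ⟨N, hN⟩ := Set.Finite.bddAbove (Set.finite_range n)
  exact ⟨N, fun i => (hn i).trans (hz (hN ⟨i, rfl⟩) i)⟩

theorem seqDense_finiteValued (X : Type*) : SeqDense (finiteValued X) := by
  intro x
  refine ⟨fun n i => min (x i) n, fun m n h i => ?_, fun n i => ?_, ?_⟩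
  · exact min_le_min le_rfl (Nat.mono_cast h)
  · exact ((min_le_right _ _).trans_lt (ENat.natCast_lt_top n)).ne
  · exact isLUB_range_pi_iff.2 fun i => isLUB_min_natCast (x i)

theorem finiteValued_of_compact {X : Type*} {a : X → ℕ∞} (ha : CompactlyBelow a a) :
    a ∈ finiteValued X :=
  (seqDense_finiteValued X).mem_of_compact ha

instance (ι : Type*) [Finite ι] : IsCuSemigroup (ι → ℕ∞) := by
  refine IsCuSemigroup.of_compactBasis (fun x => zero_le)
    (fun z _ => ⟨⨆ n, z n, isLUB_iSup⟩) ?_ (finiteValued ι) (fun k hk => compact_of_finiteValued hk)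
    (fun k hk l hl i => WithTop.add_ne_top.2 ⟨hk i, hl i⟩) (seqDense_finiteValued ι)
  intro z w s t hz hw hs ht
  rw [isLUB_range_pi_iff] at *
  exact fun i => isLUB_add_enat (fun _ _ h => hz h i) (fun _ _ h => hw h i) (hs i) (ht i)

/-- The semigroup of functions from a finite type to `ℕ∞`. -/
noncomputable abbrev finPow (ι : Type) [Finite ι] : CuSem := { carrier := ι → ℕ∞ }

/-- Composition with a map of finite sets. -/
noncomputable def pull {ι κ : Type} [Finite ι] [Finite κ] (p : κ → ι) : finPow ι ⟶ finPow κ :=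
  CuMorphism.mk { toFun := fun a k => a (p k), map_zero' := rfl, map_add' := fun _ _ => rfl }
    (fun _ _ h k => h (p k))
    (fun x y h => by
      obtain ⟨k, hk, h1, h2⟩ := (seqDense_finiteValued ι).exists_between h
      exact ((compact_of_finiteValued fun i => hk (p i)).trans_le fun i => h2 (p i)).le_trans
        fun i => h1 (p i))
    (fun _ _ _ hs => isLUB_range_pi_iff.2 fun k => isLUB_range_pi_iff.1 hs (p k))

/-! ### Isomorphisms -/

theorem isLUB_map_equiv {P Q : Type*} [PartialOrder P] [PartialOrder Q] (e : P ≃o Q) {z : ℕ → P}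
    {s : P} : IsLUB (Set.range fun n => e (z n)) (e s) ↔ IsLUB (Set.range z) s := by
  rw [← e.isLUB_image' (s := Set.range z), ← Set.range_comp]; rfl

theorem compactlyBelow_map_equiv {P Q : Type*} [PartialOrder P] [PartialOrder Q] (e : P ≃o Q)
    {x y : P} (h : CompactlyBelow x y) : CompactlyBelow (e x) (e y) := by
  intro z s hz hs hys
  obtain ⟨n, hn⟩ := h (fun n => e.symm (z n)) (e.symm s) (fun a b hab => e.symm.monotone (hz hab))
    ((isLUB_map_equiv e.symm).2 hs) (e.le_symm_apply.2 hys)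
  exact ⟨n, e.le_symm_apply.1 hn⟩

/-- An additive order isomorphism as a morphism. -/
def ofEquiv {S T : CuSem} (e : S ≃+o T) : S ⟶ T :=
  CuMorphism.mk (e : S ≃+ T).toAddMonoidHom (fun _ _ h => (map_le_map_iff e).2 h)
    (fun _ _ h => compactlyBelow_map_equiv e.toOrderIso h)
    (fun _ _ _ hs => (isLUB_map_equiv e.toOrderIso).2 hs)

theorem seqDense_compact_of_equiv {S : CuSem} {X : Type} [Finite X] (e : S ≃+o (X → ℕ∞)) :
    SeqDense {a : S | CompactlyBelow a a} := by
  intro x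
  obtain ⟨z, hz, hzK, hs⟩ := seqDense_finiteValued X (e x)
  refine ⟨fun n => e.symm (z n), fun a b hab => e.toOrderIso.symm.monotone (hz hab), fun n => ?_, ?_⟩
  · exact compactlyBelow_map_equiv e.toOrderIso.symm (compact_of_finiteValued (hzK n))
  · have := (isLUB_map_equiv e.toOrderIso.symm).2 hs
    rwa [show e.toOrderIso.symm (e x) = x from e.symm_apply_apply x] at this

theorem IsSimplicial.seqDense {S : CuSem} (h : IsSimplicial S) :
    SeqDense {a : S | CompactlyBelow a a} := by
  obtain ⟨r, _, ⟨e⟩⟩ := h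
  exact seqDense_compact_of_equiv e

/-- Morphisms out of a simplicial semigroup are determined by the images of the generators. -/
theorem ext_of_single {S T : CuSem} {X : Type} [Finite X] [DecidableEq X] (e : S ≃+o (X → ℕ∞))
    {f g : S ⟶ T}
    (h : ∀ i, f (e.symm (Pi.single i 1)) = g (e.symm (Pi.single i 1))) : f = g := by
  have := Fintype.ofFinite X
  refine CuMorphism.ext_of_dense (seqDense_compact_of_equiv e) fun k hk => ?_
  have hfin := finiteValued_of_compact (compactlyBelow_map_equiv e.toOrderIso hk)
  -- A compact `k` has finite coordinates, so it is a natural-number combination of generators.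
  have hk' : k = ∑ i, (e k i).toNat • e.symm (Pi.single i 1) := by
    apply EquivLike.injective e
    rw [map_sum]
    funext j
    simp only [map_nsmul, e.apply_symm_apply, Finset.sum_apply, Pi.smul_apply, Pi.single_apply]
    rw [Finset.sum_eq_single j]
    · simp only [nsmul_eq_mul, mul_one, if_true]
      exact (ENat.natCast_toNat (hfin j)).symm
    · intro i _ hij
      simp [hij.symm]
    · simp
  have key : ∀ u : CuMorphism S T, u k = ∑ i, (e k i).toNat • u (e.symm (Pi.single i 1)) := by
    intro u
    conv_lhs => rw [hk']
    rw [map_sum]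
    simp only [map_nsmul]
  rw [key f, key g]
  exact Finset.sum_congr rfl fun i _ => congrArg _ (h i)

/-- Reindexing. -/
def reindex {ι κ : Type} (e : ι ≃ κ) : (ι → ℕ∞) ≃+o (κ → ℕ∞) where
  toFun a k := a (e.symm k)
  invFun b i := b (e i)
  left_inv a := by funext i; simp
  right_inv b := by funext k; simp
  map_add' _ _ := rfl
  map_le_map_iff' := ⟨fun h i => by simpa using h (e i), fun h k => h _⟩

/-! ### Morphisms of the category of the Cantor set -/

theorem isSimplicial_of_equiv {S : CuSem} {ι : Type} [Finite ι] [Nonempty ι]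
    (e : S ≃+o (ι → ℕ∞)) : IsSimplicial S := by
  obtain ⟨r, ⟨f⟩⟩ := Finite.exists_equiv_fin ι
  refine ⟨r, ?_, ⟨e.trans (reindex f)⟩⟩
  rw [Nat.one_le_iff_ne_zero]
  rintro rfl
  exact (f (Classical.arbitrary ι)).elim0

theorem isSimplicial_finPow (ι : Type) [Finite ι] [Nonempty ι] : IsSimplicial (finPow ι) :=
  isSimplicial_of_equiv (S := finPow ι) (OrderAddMonoidIso.refl (ι → ℕ∞))

theorem IsSimplicial.exists_equiv {S : CuSem} (h : IsSimplicial S) :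
    ∃ r : ℕ, Nonempty (Fin r) ∧ Nonempty (S ≃+o (Fin r → ℕ∞)) := by
  obtain ⟨r, hr, e⟩ := h
  exact ⟨r, ⟨⟨0, hr⟩⟩, e⟩

theorem isSimplicialUnit_of_equiv {S : CuSem} {ι : Type} [Finite ι] (e : S ≃+o (ι → ℕ∞)) {u : S}
    (h : e u = 1) : IsSimplicialUnit S u := by
  obtain ⟨r, ⟨f⟩⟩ := Finite.exists_equiv_fin ι
  refine ⟨r, e.trans (reindex f), ?_⟩
  rw [OrderAddMonoidIso.trans_apply, h]
  rfl

theorem isSimplicialUnit_iff {S : CuSem} {ι : Type} [Finite ι] (e : S ≃+o (ι → ℕ∞)) {u : S} :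
    IsSimplicialUnit S u ↔ e u = 1 := by
  refine ⟨fun h => ?_, isSimplicialUnit_of_equiv e⟩
  have := (isSimplicialUnit_of_equiv (u := e.symm 1) e (e.apply_symm_apply 1)).eq h
  rw [← this, e.apply_symm_apply]

theorem cantorCategory_ofEquiv {S T : CuSem} (hS : IsSimplicial S) (e : S ≃+o T) :
    cantorCategory.Hom (ofEquiv e) := by
  obtain ⟨r, hr, ⟨f⟩⟩ := hS.exists_equiv
  refine ⟨hS, isSimplicial_of_equiv (e.symm.trans f), fun x y => map_le_map_iff e, fun u hu => ?_⟩
  rw [isSimplicialUnit_iff f] at hu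
  rw [isSimplicialUnit_iff (e.symm.trans f)]
  exact (congrArg f (e.symm_apply_apply u)).trans hu

theorem cantorCategory_pull {ι κ : Type} [Finite ι] [Finite κ] [Nonempty κ] {p : κ → ι}
    (hp : Function.Surjective p) : cantorCategory.Hom (pull p) := by
  have : Nonempty ι := ⟨p (Classical.arbitrary κ)⟩
  refine ⟨isSimplicial_finPow ι, isSimplicial_finPow κ, fun x y => ⟨fun h i => ?_, fun h k => h _⟩,
    fun u hu => ?_⟩
  · obtain ⟨k, rfl⟩ := hp i
    exact h k
  · rw [isSimplicialUnit_iff (S := finPow ι) (OrderAddMonoidIso.refl (ι → ℕ∞))] at hu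
    rw [isSimplicialUnit_iff (S := finPow κ) (OrderAddMonoidIso.refl (κ → ℕ∞))]
    have hu' : u = (1 : ι → ℕ∞) := hu
    subst hu'
    rfl

/-- One term equals `1`, and cancelling it kills the others. The `Pi.single` form presents the terms
as the generators evaluated at one index, which is how index maps are read off from morphisms. -/
theorem enat_sum_eq_one {ι : Type*} [Fintype ι] [DecidableEq ι] {f : ι → ℕ∞} (h : ∑ i, f i = 1) :
    ∃ i, ∀ j, f j = (Pi.single j 1 : ι → ℕ∞) i := by
  have hle : ∀ i, f i ≤ 1 := fun i => h ▸ Finset.single_le_sum (fun _ _ => zero_le) (Finset.mem_univ i)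
  obtain ⟨i, hi⟩ : ∃ i, f i ≠ 0 := by
    by_contra hcon
    push Not at hcon
    simp [hcon] at h
  have hi1 : f i = 1 := (Order.le_one_iff.1 (hle i)).resolve_left hi
  rw [← Finset.add_sum_erase _ _ (Finset.mem_univ i), hi1] at h
  have h0 : ∑ j ∈ Finset.univ.erase i, f j = 0 :=
    ENat.add_right_injective_of_ne_top (by simp : (1 : ℕ∞) ≠ ⊤) (h.trans (add_zero 1).symm)
  rw [Finset.sum_eq_zero_iff] at h0
  refine ⟨i, fun j => ?_⟩
  by_cases hj : j = i
  · subst hj; simpa using hi1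
  · rw [h0 j (by simp [hj]), Pi.single_eq_of_ne (Ne.symm hj)]

/-- A unital morphism between simplicial semigroups is the composition with a map of the index
sets. -/
theorem exists_dual {S T : CuSem} {ι κ : Type} [Finite ι] [Finite κ] (e : S ≃+o (ι → ℕ∞))
    (e' : T ≃+o (κ → ℕ∞)) {f : S ⟶ T} (hf : cantorCategory.Hom f) :
    ∃ p : κ → ι, Function.Surjective p ∧ ∀ x k, e' (f x) k = e x (p k) := by
  classical
  have := Fintype.ofFinite ι
  have hu := hf.2.2.2 _ (isSimplicialUnit_of_equiv e (e.apply_symm_apply 1))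
  rw [isSimplicialUnit_iff e'] at hu
  -- The generators sum to the unit, so their images sum to `1` in each coordinate `k`; the index
  -- carrying this `1` becomes `p k`.
  have hsum : ∀ k, ∑ i, e' (f (e.symm (Pi.single i 1))) k = 1 := by
    intro k
    have h1 : (1 : ι → ℕ∞) = ∑ i, Pi.single i 1 := (Finset.univ_sum_single (1 : ι → ℕ∞)).symm
    have h2 : e' (f (e.symm 1)) = ∑ i, e' (f (e.symm (Pi.single i 1))) := by
      rw [h1, map_sum, map_sum, map_sum]
    rw [hu] at h2
    have := congrFun h2 k
    rw [Finset.sum_apply] at this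
    exact this.symm
  choose p hp using fun k => enat_sum_eq_one (hsum k)
  have heq : f = ofEquiv (T := finPow ι) e ≫ pull p ≫ ofEquiv (S := finPow κ) e'.symm := by
    refine ext_of_single e fun i => ?_
    apply (EquivLike.injective e')
    funext k
    refine (hp k i).trans ?_
    have h1 := congrArg (fun a : ι → ℕ∞ => a (p k)) (e.apply_symm_apply (Pi.single i 1))
    exact h1.symm.trans (congrFun (e'.apply_symm_apply
      (pull p (e (e.symm (Pi.single i 1))))) k).symm
  have happ : ∀ x k, e' (f x) k = e x (p k) := by
    intro x k
    rw [heq]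
    exact congrFun (e'.apply_symm_apply (pull p (e x))) k
  refine ⟨p, fun i => ?_, happ⟩
  by_contra hi
  push Not at hi
  -- A generator outside the range of `p` would be sent to `0`, which an order-embedding forbids.
  have h0 : f (e.symm (Pi.single i 1)) ≤ f 0 := by
    rw [map_zero, ← map_le_map_iff e', map_zero]
    intro k
    rw [happ, e.apply_symm_apply, Pi.single_eq_of_ne (hi k)]
    simp
  rw [hf.2.2.1, ← map_le_map_iff e, e.apply_symm_apply, map_zero] at h0
  simpa using h0 i

/-- Indicator functions separate points; identities between morphisms thus pass to index maps. -/
theorem dual_unique {ι : Type*} {p q : ι} (h : ∀ a : ι → ℕ∞, a p = a q) : p = q := by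
  classical
  by_contra hpq
  have := h (Pi.single p 1)
  rw [Pi.single_eq_same, Pi.single_eq_of_ne (Ne.symm hpq)] at this
  exact one_ne_zero this

/-- Morphisms of the category of the Cantor set are split monomorphisms in `Cu`. -/
theorem exists_retraction {S T : CuSem} {f : S ⟶ T} (hf : cantorCategory.Hom f) :
    ∃ g : T ⟶ S, f ≫ g = 𝟙 S := by
  obtain ⟨r, _, ⟨e⟩⟩ := hf.1
  obtain ⟨s, _, ⟨e'⟩⟩ := hf.2.1
  obtain ⟨p, hp, hfp⟩ := exists_dual e e' hf
  refine ⟨ofEquiv (T := finPow (Fin s)) e' ≫ pull (Function.surjInv hp) ≫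
    ofEquiv (S := finPow (Fin r)) e.symm, ?_⟩
  refine DFunLike.ext (F := CuMorphism S S) _ _ fun x => (EquivLike.injective e) ?_
  have : pull (Function.surjInv hp) (e' (f x)) = e x := by
    funext i
    exact (hfp x _).trans (by rw [Function.surjInv_eq hp])
  exact (congrArg (fun y => e (e.symm y)) this).trans (by rw [e.apply_symm_apply]; rfl)

/-! ### Near amalgamation, joint embedding, separability -/

theorem compareOn_of_eq {S T : CuSem} (A : Finset S) {f g : S ⟶ T} (h : f = g) :
    CompareOn A f g := by
  subst h
  exact fun _ _ _ _ hx => ⟨CuMorphism.mono f hx.le, CuMorphism.mono f hx.le⟩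

theorem CompareOn.eq_of_compact {S T : CuSem} {A : Finset S} {f g : S ⟶ T} (h : CompareOn A f g)
    {x : S} (hx : x ∈ A) (hc : CompactlyBelow x x) : f x = g x :=
  (h x hx x hx hc).1.antisymm (h x hx x hx hc).2

/-- Dual to the product of two finite nonempty sets with its projections. -/
theorem cantorCategory_jep : cantorCategory.JEP := by
  intro A₁ A₂ h₁ h₂
  obtain ⟨r, hr, ⟨e⟩⟩ := h₁.exists_equiv
  obtain ⟨s, hs, ⟨e'⟩⟩ := h₂.exists_equiv
  exact ⟨finPow (Fin r × Fin s), isSimplicial_finPow _,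
    ⟨ofEquiv (T := finPow (Fin r)) e ≫ pull Prod.fst, cantorCategory.comp_mem
      (cantorCategory_ofEquiv h₁ _) (cantorCategory_pull Prod.fst_surjective)⟩,
    ⟨ofEquiv (T := finPow (Fin s)) e' ≫ pull Prod.snd, cantorCategory.comp_mem
      (cantorCategory_ofEquiv h₂ _) (cantorCategory_pull Prod.snd_surjective)⟩⟩

/-- Dual to the fibre product of two surjections, whose projections are again surjective; the square
commutes exactly. -/
theorem cantorCategory_nap : cantorCategory.NAP := by
  intro A B₁ B₂ α₁ α₂ h₁ h₂ E
  obtain ⟨r, hr, ⟨e⟩⟩ := h₁.1.exists_equiv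
  obtain ⟨s₁, hs₁, ⟨e₁⟩⟩ := h₁.2.1.exists_equiv
  obtain ⟨s₂, hs₂, ⟨e₂⟩⟩ := h₂.2.1.exists_equiv
  obtain ⟨p₁, hp₁, hα₁⟩ := exists_dual e e₁ h₁
  obtain ⟨p₂, hp₂, hα₂⟩ := exists_dual e e₂ h₂
  let Z := {x : Fin s₁ × Fin s₂ // p₁ x.1 = p₂ x.2}
  have hq₁ : Function.Surjective fun x : Z => x.1.1 := fun a =>
    let ⟨b, hb⟩ := hp₂ (p₁ a)
    ⟨⟨(a, b), hb.symm⟩, rfl⟩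
  have hq₂ : Function.Surjective fun x : Z => x.1.2 := fun b =>
    let ⟨a, ha⟩ := hp₁ (p₂ b)
    ⟨⟨(a, b), ha⟩, rfl⟩
  have : Nonempty Z := (hq₁ (Classical.arbitrary _)).nonempty
  refine ⟨finPow Z, ofEquiv (T := finPow (Fin s₁)) e₁ ≫ pull fun x : Z => x.1.1,
    ofEquiv (T := finPow (Fin s₂)) e₂ ≫ pull fun x : Z => x.1.2,
    cantorCategory.comp_mem (cantorCategory_ofEquiv h₁.2.1 _) (cantorCategory_pull hq₁),
    cantorCategory.comp_mem (cantorCategory_ofEquiv h₂.2.1 _) (cantorCategory_pull hq₂),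
    compareOn_of_eq _ ?_⟩
  refine DFunLike.ext (F := CuMorphism A (finPow Z)) _ _ fun x => funext fun z => ?_
  exact (hα₁ x z.1.1).trans ((congrArg (e x) z.2).trans (hα₂ x z.1.2).symm)

theorem isCountablyBased_of_equiv {S : CuSem} {ι : Type} [Finite ι] (e : S ≃+o (ι → ℕ∞)) :
    IsCountablyBased S := by
  refine ⟨Set.range fun a : ι → ℕ => e.symm fun i => (a i : ℕ∞), Set.countable_range _, fun x => ?_⟩
  obtain ⟨z, hz, hzK, hs⟩ := seqDense_compact_of_equiv e x
  refine ⟨z, hz, fun n => ⟨fun i => (e (z n) i).toNat, ?_⟩, hs⟩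
  have := finiteValued_of_compact (compactlyBelow_map_equiv e.toOrderIso (hzK n))
  rw [e.symm_apply_eq]
  funext i
  exact ENat.natCast_toNat (this i)

theorem IsSimplicial.isCountablyBased {S : CuSem} (h : IsSimplicial S) : IsCountablyBased S := by
  obtain ⟨r, _, ⟨e⟩⟩ := h
  exact isCountablyBased_of_equiv e

/-- The full subcategory of `cantorCategory` on the standard objects. -/
def standardCategory : CuSubcategory where
  Obj S := ∃ r : ℕ, Nonempty (Fin r) ∧ S = finPow (Fin r)
  Hom {S T} f := (∃ r : ℕ, Nonempty (Fin r) ∧ S = finPow (Fin r)) ∧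
    (∃ r : ℕ, Nonempty (Fin r) ∧ T = finPow (Fin r)) ∧ cantorCategory.Hom f
  source_mem h := h.1
  target_mem h := h.2.1
  id_mem := fun h => ⟨h, h, by
    obtain ⟨r, hr, rfl⟩ := h
    exact cantorCategory.id_mem (isSimplicial_finPow (Fin r))⟩
  comp_mem hf hg := ⟨hf.1, hg.2.1, cantorCategory.comp_mem hf.2.2 hg.2.2⟩

theorem cantorCategory_sep : cantorCategory.SEP := by
  have hobj : ∀ S, standardCategory.Obj S → IsSimplicial S := by
    rintro S ⟨r, hr, rfl⟩
    exact isSimplicial_finPow _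
  refine ⟨standardCategory, hobj, fun S T f hf => hf.2.2, fun S hS => (hobj S hS).isCountablyBased,
    ?_, ?_, ?_⟩
  -- By `exists_dual` every morphism between standard objects is `pull` of one of countably many
  -- maps.
  · refine (Set.countable_range fun x : Σ r s : ℕ, (Fin s → Fin r) =>
      (⟨finPow (Fin x.1), finPow (Fin x.2.1), pull x.2.2⟩ : Σ S T : CuSem, S ⟶ T)).mono ?_
    rintro ⟨S, T, f⟩ ⟨⟨r, hr, rfl⟩, ⟨s, hs, rfl⟩, hf⟩
    obtain ⟨p, hp, h⟩ := exists_dual (OrderAddMonoidIso.refl (Fin r → ℕ∞))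
      (OrderAddMonoidIso.refl (Fin s → ℕ∞)) hf
    refine ⟨⟨r, s, p⟩, ?_⟩
    have : pull p = f := DFunLike.ext (F := CuMorphism (finPow (Fin r)) (finPow (Fin s))) _ _
      fun x => funext fun k => (h x k).symm
    dsimp only
    rw [this]
  · intro A hA
    obtain ⟨r, hr, ⟨e⟩⟩ := IsSimplicial.exists_equiv hA
    exact ⟨finPow (Fin r), ⟨r, hr, rfl⟩, ofEquiv (T := finPow (Fin r)) e,
      cantorCategory_ofEquiv hA _⟩
  · intro S A σ hS hσ E
    obtain ⟨r, hr, ⟨e⟩⟩ := hσ.2.1.exists_equiv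
    have h1 := cantorCategory_ofEquiv (T := finPow (Fin r)) hσ.2.1 e
    exact ⟨finPow (Fin r), ofEquiv (T := finPow (Fin r)) e, σ ≫ ofEquiv (T := finPow (Fin r)) e,
      ⟨r, hr, rfl⟩, h1, ⟨hS, ⟨r, hr, rfl⟩, cantorCategory.comp_mem hσ h1⟩, compareOn_of_eq _ rfl⟩

/-! ### Limits of inductive sequences in the category of the Cantor set -/

theorem seqDense_of_hasSequence {F : ℕ ⥤ CuSem} (hF : cantorCategory.HasSequence F) (i : ℕ) :
    SeqDense {a : F.obj i | CompactlyBelow a a} :=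
  IsSimplicial.seqDense (hF.1 i)

/-- Compatible retractions onto a term of an inductive sequence. -/
noncomputable def retractionTo (F : ℕ ⥤ CuSem) (ρ : ∀ j, F.obj (j + 1) ⟶ F.obj j) (i : ℕ) :
    ∀ j, F.obj j ⟶ F.obj i
  | 0 => F.map (homOfLE (Nat.zero_le i))
  | j + 1 => if h : j + 1 ≤ i then F.map (homOfLE h) else ρ j ≫ retractionTo F ρ i j

theorem retractionTo_of_le (F : ℕ ⥤ CuSem) (ρ : ∀ j, F.obj (j + 1) ⟶ F.obj j) {i j : ℕ}
    (h : j ≤ i) : retractionTo F ρ i j = F.map (homOfLE h) := by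
  cases j with
  | zero => rfl
  | succ j => rw [retractionTo, dif_pos h]

theorem map_retractionTo_succ (F : ℕ ⥤ CuSem) (ρ : ∀ j, F.obj (j + 1) ⟶ F.obj j)
    (hρ : ∀ j, F.map (homOfLE j.le_succ) ≫ ρ j = 𝟙 _) (i j : ℕ) :
    F.map (homOfLE j.le_succ) ≫ retractionTo F ρ i (j + 1) = retractionTo F ρ i j := by
  by_cases h : j + 1 ≤ i
  · rw [retractionTo_of_le F ρ h, retractionTo_of_le F ρ (j.le_succ.trans h), ← F.map_comp]
    rfl
  · rw [retractionTo, dif_neg h, ← Category.assoc, hρ, Category.id_comp]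

section

variable {F : ℕ ⥤ CuSem} {S : CuSem} {ι : F ⟶ (Functor.const ℕ).obj S}

/-- Connecting maps are split monomorphisms, so their retractions assemble into a cocone over `F.obj
i`; the induced map out of the limit is a left inverse of `leg ι i`. -/
theorem leg_le_leg (hF : cantorCategory.HasSequence F) (h : IsCuLimit F S ι) {i : ℕ}
    {a b : F.obj i} : leg ι i a ≤ leg ι i b ↔ a ≤ b := by
  refine ⟨fun hab => ?_, fun hab => CuMorphism.mono _ hab⟩
  obtain ⟨h⟩ := h
  choose ρ hρ using fun j => exists_retraction (hF.2 j (j + 1) j.le_succ)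
  let κ : F ⟶ (Functor.const ℕ).obj (F.obj i) := NatTrans.ofSequence (retractionTo F ρ i) fun j => by
    rw [map_retractionTo_succ F ρ hρ]
    exact (Category.comp_id _).symm
  have h1 : leg ι i ≫ h.desc (Cocone.mk _ κ) = 𝟙 _ := by
    refine (h.fac (Cocone.mk _ κ) i).trans ?_
    change retractionTo F ρ i i = _
    rw [retractionTo_of_le F ρ le_rfl]
    exact F.map_id i
  have h2 : ∀ x, h.desc (Cocone.mk _ κ) (leg ι i x) = x := fun x =>
    congrArg (fun f : F.obj i ⟶ F.obj i => f x) h1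
  rw [← h2 a, ← h2 b]
  exact CuMorphism.mono _ hab

theorem leg_injective (hF : cantorCategory.HasSequence F) (h : IsCuLimit F S ι) {i : ℕ}
    {a b : F.obj i} (hab : leg ι i a = leg ι i b) : a = b :=
  ((leg_le_leg hF h).1 hab.le).antisymm ((leg_le_leg hF h).1 hab.ge)

theorem dense_of_limit (hF : cantorCategory.HasSequence F) (h : IsCuLimit F S ι) :
    SeqDense (compactImages ι) :=
  h.seqDense (seqDense_of_hasSequence hF)

end

/-! ### Units -/

/-- `u` is the largest element above no nonzero `y + y`. This describes the unit of a limit of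
simplicial semigroups intrinsically. -/
def IsUnitElement {S : CuSem} (u : S) : Prop :=
  IsGreatest {x : S | ∀ y, y + y ≤ x → y = 0} u

theorem IsUnitElement.eq {S : CuSem} {u v : S} (hu : IsUnitElement u) (hv : IsUnitElement v) :
    u = v :=
  hu.unique hv

theorem isUnitElement_one (X : Type) [Finite X] : IsUnitElement (S := finPow X) (1 : X → ℕ∞) := by
  classical
  refine ⟨fun y hy => funext fun i => ?_, fun x hx i => ?_⟩
  · by_contra h
    have h1 : (1 : ℕ∞) ≤ (y : X → ℕ∞) i := Order.one_le_iff_ne_zero.2 h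
    have h2 := (add_le_add h1 h1).trans (hy i)
    exact absurd (show (1 : ℕ∞) + 1 ≤ 1 from h2) (by decide)
  · by_contra h
    rw [not_le] at h
    have h2 : (Pi.single i 1 : X → ℕ∞) + Pi.single i 1 ≤ (x : X → ℕ∞) := by
      intro j
      by_cases hj : j = i
      · subst hj
        simpa using Order.add_one_le_of_lt h
      · simp [hj]
    have h3 : (Pi.single i 1 : X → ℕ∞) i = 0 := congrFun (hx _ h2) i
    simp at h3

theorem isUnitElement_map_equiv {S T : CuSem} (e : S ≃+o T) {u : S} (h : IsUnitElement u) :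
    IsUnitElement (e u) := by
  refine ⟨fun y hy => ?_, fun x hx => ?_⟩
  · have := h.1 (e.symm y) (by rw [← map_add, ← map_le_map_iff e, e.apply_symm_apply]; exact hy)
    rw [e.symm_apply_eq] at this
    rw [this, map_zero]
  · have : e.symm x ≤ u := h.2 fun y hy => by
      rw [← map_le_map_iff e, map_add, e.apply_symm_apply] at hy
      apply EquivLike.injective e
      rw [hx _ hy, map_zero]
    rwa [← map_le_map_iff e, e.apply_symm_apply] at this

theorem IsSimplicialUnit.isUnitElement {S : CuSem} {u : S} (h : IsSimplicialUnit S u) :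
    IsUnitElement u := by
  obtain ⟨r, e, he⟩ := h
  have := isUnitElement_map_equiv (S := finPow (Fin r)) e.symm (isUnitElement_one (Fin r))
  rwa [show e.symm (1 : Fin r → ℕ∞) = u from e.symm_apply_eq.2 he.symm] at this

theorem IsSimplicial.exists_unit {S : CuSem} (h : IsSimplicial S) : ∃ u, IsSimplicialUnit S u := by
  obtain ⟨r, _, ⟨e⟩⟩ := h
  exact ⟨e.symm 1, r, e, e.apply_symm_apply 1⟩

theorem isSimplicialUnit_iff_isUnitElement {S : CuSem} (hS : IsSimplicial S) {u : S} :
    IsSimplicialUnit S u ↔ IsUnitElement u := by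
  refine ⟨fun h => h.isUnitElement, fun h => ?_⟩
  obtain ⟨v, hv⟩ := hS.exists_unit
  rwa [h.eq hv.isUnitElement]

/-- Connecting maps preserve units, legs reflect order, and compact images are dense. Both defining
conditions can thus be tested at a late finite stage. -/
theorem isUnitElement_leg {F : ℕ ⥤ CuSem} {S : CuSem} {ι : F ⟶ (Functor.const ℕ).obj S}
    (hF : cantorCategory.HasSequence F) (h : IsCuLimit F S ι) {i : ℕ} {u : F.obj i}
    (hu : IsSimplicialUnit (F.obj i) u) : IsUnitElement (leg ι i u) := by
  have hd := dense_of_limit hF h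
  have stage : ∀ j, i ≤ j → ∀ v : F.obj j, IsSimplicialUnit (F.obj j) v →
      leg ι j v = leg ι i u := by
    intro j hij v hv
    rw [← leg_map hij u, hv.eq ((hF.2 i j hij).2.2.2 u hu)]
  refine ⟨fun y hy => ?_, fun x hx => ?_⟩
  · obtain ⟨z, hz, hzK, hzy⟩ := hd y
    have hz0 : ∀ n, z n = 0 := by
      intro n
      obtain ⟨j, hj⟩ := exists_eq_leg_of_le (hzK n)
      obtain ⟨a, ha, hax⟩ := hj _ (le_max_right i j)
      obtain ⟨v, hv⟩ := IsSimplicial.exists_unit (hF.1 (max i j))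
      have hle : a + a ≤ v := by
        rw [← leg_le_leg hF h, map_add, hax, stage _ (le_max_left i j) v hv]
        exact (add_le_add (hzy.1 ⟨n, rfl⟩) (hzy.1 ⟨n, rfl⟩)).trans hy
      rw [← hax, hv.isUnitElement.1 a hle, map_zero]
    simp only [funext hz0] at hzy
    exact hzy.unique (isLUB_range_const 0)
  · obtain ⟨z, hz, hzK, hzx⟩ := hd x
    refine hzx.2 ?_
    rintro _ ⟨n, rfl⟩
    obtain ⟨j, hj⟩ := exists_eq_leg_of_le (hzK n)
    obtain ⟨a, ha, hax⟩ := hj _ (le_max_right i j)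
    obtain ⟨v, hv⟩ := IsSimplicial.exists_unit (hF.1 (max i j))
    have hle : a ≤ v := hv.isUnitElement.2 fun y hy => by
      have h1 : leg ι _ y = 0 := hx _ (by
        rw [← map_add]
        exact (CuMorphism.mono _ hy).trans (hax.trans_le (hzx.1 ⟨n, rfl⟩)))
      exact leg_injective hF h (h1.trans (map_zero _).symm)
    rw [← hax, ← stage _ (le_max_left i j) v hv]
    exact CuMorphism.mono _ hle

/-! ### The morphisms of the completion -/

/-- Order-embeddings that preserve the unit. -/
def IsUnitalEmbedding {S T : CuSem} (f : S ⟶ T) : Prop :=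
  (∀ x y : S, f x ≤ f y → x ≤ y) ∧ ∀ u : S, IsUnitElement u → IsUnitElement (f u)

/-- It suffices to check that a map out of a limit is a unital embedding on the terms of a
sequence. -/
theorem isUnitalEmbedding_of_legs {F : ℕ ⥤ CuSem} {S T : CuSem} {ι : F ⟶ (Functor.const ℕ).obj S}
    (hF : cantorCategory.HasSequence F) (h : IsCuLimit F S ι) (f : S ⟶ T)
    (hle : ∀ i (a b : F.obj i), CompactlyBelow a a → CompactlyBelow b b →
      f (leg ι i a) ≤ f (leg ι i b) → a ≤ b)
    (hu : ∀ u : F.obj 0, IsSimplicialUnit (F.obj 0) u → IsUnitElement (f (leg ι 0 u))) :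
    IsUnitalEmbedding f := by
  refine ⟨fun x y hxy => ?_, fun u hu' => ?_⟩
  · refine (CuMorphism.le_iff_of_dense f (dense_of_limit hF h)
      (fun k hk => compact_of_mem_compactImages hk) ?_ x y).1 hxy
    intro k hk l hl hkl
    obtain ⟨i, a, b, ha, hb, rfl, rfl⟩ := exists_common_stage hk hl
    exact CuMorphism.mono _ (hle i a b ha hb hkl)
  · obtain ⟨v, hv⟩ := IsSimplicial.exists_unit (hF.1 0)
    rw [hu'.eq (isUnitElement_leg hF h hv)]
    exact hu v hv

/-- Near equality is equality on compact elements. On compact images `f` therefore agrees with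
connecting maps, some `α j` and a leg of the target, all of which are unital embeddings. -/
theorem IsUnitalEmbedding.of_completion_hom {S T : CuSem} {f : S ⟶ T}
    (hf : cantorCategory.completion.Hom f) : IsUnitalEmbedding f := by
  classical
  obtain ⟨⟨F, ι, hF, hS⟩, -, hf⟩ := hf
  obtain ⟨G, κ, φ, hφ, α, hG, hT, hα, -, hind⟩ := hf F ι hF hS
  have key : ∀ i (A : Finset (F.obj i)), (∀ a ∈ A, CompactlyBelow a a) → ∃ (j : ℕ) (hij : i ≤ j),
      ∀ a ∈ A, f (leg ι i a) = leg κ (φ j) (α j (F.map (homOfLE hij) a)) := by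
    intro i A hA
    obtain ⟨j, hij, hj⟩ := hind i A
    refine ⟨j, hij, fun a ha => ?_⟩
    exact (hj j hij le_rfl).eq_of_compact ha (hA a ha)
  refine isUnitalEmbedding_of_legs hF hS f ?_ ?_
  · intro i a b ha hb hab
    obtain ⟨j, hij, hj⟩ := key i {a, b} (by simp [ha, hb])
    rw [hj a (by simp), hj b (by simp), leg_le_leg hG hT] at hab
    exact ((hF.2 i j hij).2.2.1 _ _).1 (((hα j).2.2.1 _ _).1 hab)
  · intro u hu
    have huc : CompactlyBelow u u := by
      obtain ⟨r, e, he⟩ := hu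
      have h1 := compactlyBelow_map_equiv e.toOrderIso.symm
        (compact_of_finiteValued (a := e u) (by rw [he]; intro i; simp))
      rwa [show e.toOrderIso.symm (e u) = u from e.symm_apply_apply u] at h1
    obtain ⟨j, hij, hj⟩ := key 0 {u} (by simp [huc])
    rw [hj u (by simp)]
    exact isUnitElement_leg hG hT ((hα j).2.2.2 _ ((hF.2 0 j hij).2.2.2 u hu))

/-- A unital embedding of a simplicial semigroup into a limit factors through all late stages. -/
theorem exists_factorization {A : CuSem} (hA : IsSimplicial A) {G : ℕ ⥤ CuSem} {T : CuSem}
    {κ : G ⟶ (Functor.const ℕ).obj T} (hG : cantorCategory.HasSequence G) (hT : IsCuLimit G T κ)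
    {f : A ⟶ T} (hf : IsUnitalEmbedding f) :
    ∃ N, ∀ n, N ≤ n → ∃ α : A ⟶ G.obj n, cantorCategory.Hom α ∧ α ≫ leg κ n = f := by
  classical
  obtain ⟨r, hr, ⟨e⟩⟩ := hA.exists_equiv
  have hc : ∀ i, CompactlyBelow (e.symm (Pi.single i 1)) (e.symm (Pi.single i 1)) := fun i =>
    compactlyBelow_map_equiv e.toOrderIso.symm (compact_of_finiteValued fun j => by
      by_cases h : j = i
      · subst h; simp
      · simp [h])
  have hmem : ∀ i, f (e.symm (Pi.single i 1)) ∈ compactImages κ := fun i =>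
    (dense_of_limit hG hT).mem_of_compact (CuMorphism.map_compact _ (hc i))
  choose n₀ hn₀ using fun i => exists_eq_leg_of_le (hmem i)
  refine ⟨Finset.univ.sup n₀, fun n hn => ?_⟩
  choose b _ hb using fun i => hn₀ i n ((Finset.le_sup (Finset.mem_univ i)).trans hn)
  obtain ⟨s, hs, ⟨e'⟩⟩ := IsSimplicial.exists_equiv (hG.1 n)
  -- Both sides have the unit element of `T` as image, and legs are injective. The `b i` thus form a
  -- partition of the unit at stage `n`.
  have hunit : ∑ i, b i = e'.symm 1 := by
    apply leg_injective hG hT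
    have h1 := isUnitElement_leg hG hT
      (isSimplicialUnit_of_equiv (S := G.obj n) (u := e'.symm 1) e' (e'.apply_symm_apply 1))
    have h2 := hf.2 _ (isSimplicialUnit_of_equiv (u := e.symm 1) e
      (e.apply_symm_apply 1)).isUnitElement
    rw [← h2.eq h1, map_sum]
    have h3 : (1 : Fin r → ℕ∞) = ∑ i, Pi.single i 1 :=
      (Finset.univ_sum_single (1 : Fin r → ℕ∞)).symm
    rw [h3, map_sum, map_sum]
    exact Finset.sum_congr rfl fun i _ => hb i
  have hsum : ∀ k, ∑ i, e' (b i) k = 1 := by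
    intro k
    have h1 := congrFun (congrArg e' hunit) k
    rw [map_sum, e'.apply_symm_apply, Finset.sum_apply] at h1
    exact h1
  choose p hp using fun k => enat_sum_eq_one (hsum k)
  let α : A ⟶ G.obj n := ofEquiv (T := finPow (Fin r)) e ≫ pull p ≫
    ofEquiv (S := finPow (Fin s)) e'.symm
  have hα : ∀ x k, e' (α x) k = e x (p k) := fun x k =>
    congrFun (e'.apply_symm_apply (pull p (e x))) k
  have hfac : α ≫ leg κ n = f := by
    refine ext_of_single e fun i => Eq.trans ?_ (hb i)
    refine congrArg (leg κ n) (EquivLike.injective e' (funext fun k => ?_))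
    exact (hα _ k).trans (by rw [e.apply_symm_apply, ← hp])
  have hsurj : Function.Surjective p := by
    intro i
    by_contra hi
    push Not at hi
    have h0 : b i = 0 := by
      apply EquivLike.injective e'
      funext k
      rw [hp k i, map_zero, Pi.single_eq_of_ne (hi k)]
      rfl
    have h1 := hb i
    rw [h0, map_zero] at h1
    have h2 := hf.1 (e.symm (Pi.single i 1)) 0 (by rw [← h1, map_zero])
    rw [← map_le_map_iff e, e.apply_symm_apply, map_zero] at h2
    simpa using h2 i
  exact ⟨α, cantorCategory.comp_mem (cantorCategory_ofEquiv hA _) (cantorCategory.comp_mem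
    (cantorCategory_pull hsurj) (cantorCategory_ofEquiv (isSimplicial_finPow _) _)), hfac⟩

theorem leg_isUnitalEmbedding {F : ℕ ⥤ CuSem} {S : CuSem} {ι : F ⟶ (Functor.const ℕ).obj S}
    (hF : cantorCategory.HasSequence F) (h : IsCuLimit F S ι) (i : ℕ) :
    IsUnitalEmbedding (leg ι i) :=
  ⟨fun _ _ => (leg_le_leg hF h).1, fun _ hu =>
    isUnitElement_leg hF h ((isSimplicialUnit_iff_isUnitElement (hF.1 i)).2 hu)⟩

theorem IsUnitalEmbedding.comp {S T U : CuSem} {f : S ⟶ T} {g : T ⟶ U}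
    (hf : IsUnitalEmbedding f) (hg : IsUnitalEmbedding g) : IsUnitalEmbedding (f ≫ g) :=
  ⟨fun x y h => hf.1 x y (hg.1 _ _ h), fun u hu => hg.2 _ (hf.2 u hu)⟩

/-- One presentation of `T` serves every presentation of `S`: each leg followed by `f` factors
exactly through it. Injectivity of the legs makes the intertwining squares commute exactly. -/
theorem IsUnitalEmbedding.completion_hom {S T : CuSem} {f : S ⟶ T} (hf : IsUnitalEmbedding f)
    (hS : cantorCategory.CompletionObj S) (hT : cantorCategory.CompletionObj T) :
    cantorCategory.completion.Hom f := by
  refine ⟨hS, hT, fun F ι hF hι => ?_⟩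
  obtain ⟨G, κ, hG, hκ⟩ := hT
  have hex := fun i => exists_factorization (hF.1 i) hG hκ ((leg_isUnitalEmbedding hF hι i).comp hf)
  -- Factorizations exist at all late stages, so the stages can be chosen strictly increasing.
  obtain ⟨φ, hφ, h⟩ := Filter.extraction_forall_of_eventually' hex
  choose α hα hfac using h
  have hκn : ∀ {m n : ℕ} (hmn : m ≤ n), G.map (homOfLE hmn) ≫ leg κ n = leg κ m := fun hmn =>
    DFunLike.ext (F := CuMorphism _ _) _ _ fun a => leg_map hmn a
  have hιn : ∀ {m n : ℕ} (hmn : m ≤ n), F.map (homOfLE hmn) ≫ leg ι n = leg ι m := fun hmn =>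
    DFunLike.ext (F := CuMorphism _ _) _ _ fun a => leg_map hmn a
  refine ⟨G, κ, φ, hφ, α, hG, hκ, hα, ?_, ?_⟩
  · refine fun i A => ⟨i, le_rfl, fun j k hij hjk _ => compareOn_of_eq A ?_⟩
    have h1 : (F.map (homOfLE (hij.trans hjk)) ≫ α k) ≫ leg κ (φ k) = leg ι i ≫ f := by
      rw [Category.assoc, hfac, ← Category.assoc, hιn]
    have h2 : (F.map (homOfLE hij) ≫ α j ≫ G.map (homOfLE (hφ.monotone hjk))) ≫ leg κ (φ k) =
        leg ι i ≫ f := by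
      rw [Category.assoc, Category.assoc, hκn, hfac, ← Category.assoc, hιn]
    refine DFunLike.ext (F := CuMorphism _ _) _ _ fun a => leg_injective hG hκ (i := φ k) ?_
    exact congrArg (fun g : F.obj i ⟶ T => g a) (h1.trans h2.symm)
  · refine fun i A => ⟨i, le_rfl, fun j hij _ => compareOn_of_eq A ?_⟩
    change leg ι i ≫ f = F.map (homOfLE hij) ≫ α j ≫ leg κ (φ j)
    rw [hfac, ← Category.assoc, hιn]

theorem completionObj_of_isSimplicial {A : CuSem} (hA : IsSimplicial A) :
    cantorCategory.CompletionObj A := by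
  let F : ℕ ⥤ CuSem := (Functor.const ℕ).obj A
  refine ⟨F, 𝟙 F, ⟨fun _ => hA, fun _ _ _ => cantorCategory.id_mem hA⟩,
    isCuLimit_of_dense (fun _ _ _ h => h) (fun _ => hA.seqDense) fun x => ?_⟩
  obtain ⟨z, hz, hzK, hs⟩ := hA.seqDense x
  exact ⟨z, hz, fun n => ⟨0, z n, hzK n, rfl⟩, hs⟩

/-- A limit in `Cu` of a sequence in the category of the Cantor set is a limit in the
completion. -/
theorem IsCuLimit.completion_isLimit {F : ℕ ⥤ CuSem} {S : CuSem}
    {ι : F ⟶ (Functor.const ℕ).obj S} (hF : cantorCategory.HasSequence F) (h : IsCuLimit F S ι) :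
    cantorCategory.completion.IsLimit F S ι := by
  have hS : cantorCategory.CompletionObj S := ⟨F, ι, hF, h⟩
  refine ⟨hS, fun i => (leg_isUnitalEmbedding hF h i).completion_hom
    (completionObj_of_isSimplicial (hF.1 i)) hS, fun D κ hD hκ => ?_⟩
  have hκ' := fun i => IsUnitalEmbedding.of_completion_hom (hκ i)
  obtain ⟨hc⟩ := id h
  have hfac : ∀ i, leg ι i ≫ hc.desc (Cocone.mk D κ) = leg κ i := fun i => hc.fac (Cocone.mk D κ) i
  have happ : ∀ i a, hc.desc (Cocone.mk D κ) (leg ι i a) = leg κ i a := fun i a =>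
    congrArg (fun g : F.obj i ⟶ D => g a) (hfac i)
  refine ⟨hc.desc (Cocone.mk D κ), ⟨?_, hfac⟩, fun g hg => hc.hom_ext fun i =>
    (hg.2 i).trans (hfac i).symm⟩
  refine (isUnitalEmbedding_of_legs hF h _ ?_ ?_).completion_hom hS hD
  · intro i a b _ _ hab
    rw [happ, happ] at hab
    exact (hκ' i).1 a b hab
  · intro u hu
    rw [happ]
    exact (hκ' 0).2 u hu.isUnitElement

/-! ### Lower-semicontinuous functions on the Cantor set -/

/-- Pointwise suprema of lower-semicontinuous functions are lower-semicontinuous. -/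
theorem isLUB_lsc_iff {X : Type*} [TopologicalSpace X] {z : ℕ → Lsc X} {s : Lsc X} :
    IsLUB (Set.range z) s ↔ ∀ x, IsLUB (Set.range fun n => (z n).1 x) (s.1 x) := by
  have hback : ∀ t : Lsc X, IsLUB (Set.range fun n => (z n).1) t.1 → IsLUB (Set.range z) t := by
    refine fun t ht => ⟨?_, fun u hu => ?_⟩
    · rintro _ ⟨n, rfl⟩
      exact ht.1 ⟨n, rfl⟩
    · have hu' : u.1 ∈ upperBounds (Set.range fun n => (z n).1) := by
        rintro _ ⟨n, rfl⟩
        exact hu ⟨n, rfl⟩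
      exact ht.2 hu'
  rw [← isLUB_range_pi_iff (z := fun n => (z n).1)]
  refine ⟨fun hs => ?_, hback s⟩
  have hsup : IsLUB (Set.range fun n => (z n).1) (⨆ n, (z n).1) := isLUB_iSup
  have hl : LowerSemicontinuous (⨆ n, (z n).1) := by
    rw [show (⨆ n, (z n).1) = fun x => ⨆ n, (z n).1 x from funext fun x => iSup_apply]
    exact lowerSemicontinuous_iSup fun n => (z n).2
  have := hs.unique (hback ⟨_, hl⟩ hsup)
  rw [this]
  exact hsup

theorem exists_isLUB_lsc {X : Type*} [TopologicalSpace X] (z : ℕ → Lsc X) :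
    ∃ s, IsLUB (Set.range z) s := by
  refine ⟨⟨fun x => ⨆ n, (z n).1 x, lowerSemicontinuous_iSup fun n => (z n).2⟩, ?_⟩
  exact isLUB_lsc_iff.2 fun x => isLUB_iSup

theorem eq_of_mem_cylinder {α : Type*} {n : ℕ} {f : (ℕ → Bool) → α}
    (hf : DependsOn f (Set.Iio n)) {x y : ℕ → Bool} (h : y ∈ PiNat.cylinder x n) : f y = f x :=
  hf fun i hi => PiNat.mem_cylinder_iff.1 h i hi

theorem eventually_mem_cylinder (x : ℕ → Bool) (n : ℕ) :
    ∀ᶠ y in nhds x, y ∈ PiNat.cylinder x n :=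
  (PiNat.isOpen_cylinder _ x n).mem_nhds (PiNat.self_mem_cylinder x n)

theorem exists_cylinder_subset {x : ℕ → Bool} {p : (ℕ → Bool) → Prop} (h : ∀ᶠ y in nhds x, p y) :
    ∃ n, ∀ y ∈ PiNat.cylinder x n, p y := by
  obtain ⟨_, ⟨y, n, rfl⟩, hx, hs⟩ :=
    (PiNat.isTopologicalBasis_cylinders fun _ : ℕ => Bool).mem_nhds_iff.1 h
  rw [← PiNat.mem_cylinder_iff_eq.1 hx] at hs
  exact ⟨n, fun y hy => hs hy⟩

theorem lowerSemicontinuous_of_dependsOn {n : ℕ} {f : (ℕ → Bool) → ℕ∞}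
    (hf : DependsOn f (Set.Iio n)) : LowerSemicontinuous f := by
  intro x m hm
  filter_upwards [eventually_mem_cylinder x n] with y hy
  rwa [eq_of_mem_cylinder hf hy]

/-- For `m = k + 1` the condition `m ≤ f y` is the open condition `k < f y`. -/
theorem eventually_le_of_lowerSemicontinuous {X : Type*} [TopologicalSpace X] {f : X → ℕ∞}
    (hf : LowerSemicontinuous f) {m : ℕ∞} (hm : m ≠ ⊤) {x : X} (h : m ≤ f x) :
    ∀ᶠ y in nhds x, m ≤ f y := by
  lift m to ℕ using hm
  cases m with
  | zero => simp
  | succ m =>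
    have h1 : (m : ℕ∞) < f x := lt_of_lt_of_le (by exact_mod_cast m.lt_succ_self) h
    filter_upwards [hf x m h1] with y hy
    simpa using Order.add_one_le_of_lt hy

/-- The finite-valued functions that depend on finitely many coordinates. -/
def locallyConstant : Set (Lsc (ℕ → Bool)) :=
  {g | (∃ n, DependsOn g.1 (Set.Iio n)) ∧ g.1 ∈ finiteValued _}

/-- Near each point `g` is a finite constant, which a single `z n` dominates on a neighbourhood. A
finite subcover of the Cantor set gives one `n` for all points. -/
theorem compact_of_locallyConstant {g : Lsc (ℕ → Bool)} (hg : g ∈ locallyConstant) :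
    CompactlyBelow g g := by
  obtain ⟨⟨n, hn⟩, hfin⟩ := hg
  intro z s hz hs hgs
  rw [isLUB_lsc_iff] at hs
  choose N hN using fun x => enat_compact (hfin x) (hs x) (hgs x)
  have hev : ∀ x, ∀ᶠ y in nhds x, g.1 y ≤ (z (N x)).1 y := by
    intro x
    filter_upwards [eventually_mem_cylinder x n,
      eventually_le_of_lowerSemicontinuous (z (N x)).2 (hfin x) (hN x)] with y hy1 hy2
    rwa [eq_of_mem_cylinder hn hy1]
  obtain ⟨t, -, ht⟩ := isCompact_univ.elim_nhds_subcover _ fun x _ => hev x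
  refine ⟨t.sup N, fun y => ?_⟩
  obtain ⟨x, hx, hy⟩ := Set.mem_iUnion₂.1 (ht (Set.mem_univ y))
  exact le_trans hy (hz (Finset.le_sup hx) y)

/-- The infimum over cylinders of the truncations of a function. -/
noncomputable def cylinderInf (g : (ℕ → Bool) → ℕ∞) (n : ℕ) (x : ℕ → Bool) : ℕ∞ :=
  ⨅ y : PiNat.cylinder x n, min (n : ℕ∞) (g y)

theorem dependsOn_cylinderInf (g : (ℕ → Bool) → ℕ∞) (n : ℕ) :
    DependsOn (cylinderInf g n) (Set.Iio n) := by
  intro x y h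
  have : PiNat.cylinder x n = PiNat.cylinder y n :=
    PiNat.mem_cylinder_iff_eq.1 (PiNat.mem_cylinder_iff.2 fun i hi => h i hi)
  rw [cylinderInf, cylinderInf, this]

theorem cylinderInf_le (g : (ℕ → Bool) → ℕ∞) (n : ℕ) (x : ℕ → Bool) :
    cylinderInf g n x ≤ min (n : ℕ∞) (g x) :=
  iInf_le (fun y : PiNat.cylinder x n => min (n : ℕ∞) (g y)) ⟨x, PiNat.self_mem_cylinder x n⟩

theorem monotone_cylinderInf (g : (ℕ → Bool) → ℕ∞) : Monotone (cylinderInf g) := by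
  intro m n hmn x
  refine le_iInf fun y => ?_
  refine (iInf_le (fun y : PiNat.cylinder x m => min (m : ℕ∞) (g y))
    ⟨y, PiNat.cylinder_anti x hmn y.2⟩).trans ?_
  exact min_le_min (Nat.mono_cast hmn) le_rfl

theorem isLUB_cylinderInf {g : (ℕ → Bool) → ℕ∞} (hg : LowerSemicontinuous g) (x : ℕ → Bool) :
    IsLUB (Set.range fun n => cylinderInf g n x) (g x) := by
  refine ⟨?_, fun u hu => ?_⟩
  · rintro _ ⟨n, rfl⟩
    exact (cylinderInf_le g n x).trans (min_le_right _ _)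
  · by_contra h
    rw [not_le] at h
    obtain ⟨N, hN⟩ := exists_cylinder_subset (hg x u h)
    lift u to ℕ using h.ne_top
    -- Level at least `N` confines the cylinder to `g > u`; level at least `u + 1` keeps the
    -- truncation from cutting off `u + 1`.
    have h1 : ((u + 1 : ℕ) : ℕ∞) ≤ cylinderInf g (max N (u + 1)) x := by
      refine le_iInf fun y => le_min (Nat.mono_cast (le_max_right _ _)) ?_
      have := hN y (PiNat.cylinder_anti x (le_max_left _ _) y.2)
      simpa using Order.add_one_le_of_lt this
    have h2 : ((u + 1 : ℕ) : ℕ∞) ≤ (u : ℕ∞) := h1.trans (hu ⟨_, rfl⟩)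
    have h3 : u + 1 ≤ u := by exact_mod_cast h2
    omega

theorem exists_locallyConstant_approx (g : Lsc (ℕ → Bool)) :
    ∃ z : ℕ → Lsc (ℕ → Bool), Monotone z ∧
      (∀ n, DependsOn (z n).1 (Set.Iio n) ∧ (z n).1 ∈ finiteValued _) ∧ IsLUB (Set.range z) g :=
  ⟨fun n => ⟨cylinderInf g.1 n, lowerSemicontinuous_of_dependsOn (dependsOn_cylinderInf g.1 n)⟩,
    monotone_cylinderInf g.1, fun n => ⟨dependsOn_cylinderInf g.1 n, fun x =>
      (((cylinderInf_le g.1 n x).trans (min_le_left _ _)).trans_lt (ENat.natCast_lt_top n)).ne⟩,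
    isLUB_lsc_iff.2 (isLUB_cylinderInf g.2)⟩

instance : IsCuSemigroup (Lsc (ℕ → Bool)) := by
  refine IsCuSemigroup.of_compactBasis (fun x _ => zero_le)
    (fun z _ => exists_isLUB_lsc z) ?_ locallyConstant (fun k hk => compact_of_locallyConstant hk)
    ?_ ?_
  · intro z w s t hz hw hs ht
    rw [isLUB_lsc_iff] at *
    exact fun x => isLUB_add_enat (fun _ _ h => hz h x) (fun _ _ h => hw h x) (hs x) (ht x)
  · rintro k ⟨⟨m, hm⟩, hk⟩ l ⟨⟨n, hn⟩, hl⟩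
    refine ⟨⟨max m n, fun x y h => ?_⟩, fun x => WithTop.add_ne_top.2 ⟨hk x, hl x⟩⟩
    exact congrArg₂ (· + ·) (hm fun i hi => h i (lt_of_lt_of_le hi (le_max_left m n)))
      (hn fun i hi => h i (lt_of_lt_of_le hi (le_max_right m n)))
  · intro g
    obtain ⟨z, hz, hzK, hs⟩ := exists_locallyConstant_approx g
    exact ⟨z, hz, fun n => ⟨⟨n, (hzK n).1⟩, (hzK n).2⟩, hs⟩

/-- `Lsc(2^ℕ, ℕ∞)` as an object of `Cu`. -/
noncomputable abbrev cantorLsc : CuSem := { carrier := Lsc (ℕ → Bool) }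

/-- Composition with a map from the Cantor set to a finite set that depends on finitely many
coordinates. -/
noncomputable def pullLsc {ι : Type} [Finite ι] (π : (ℕ → Bool) → ι) {n : ℕ}
    (hπ : DependsOn π (Set.Iio n)) : finPow ι ⟶ cantorLsc :=
  have hdep : ∀ a : ι → ℕ∞, DependsOn (fun x => a (π x)) (Set.Iio n) :=
    fun a _ _ h => congrArg a (hπ h)
  CuMorphism.mk
    { toFun := fun a => (⟨fun x => a (π x), lowerSemicontinuous_of_dependsOn (hdep a)⟩ :
        Lsc (ℕ → Bool))
      map_zero' := rfl
      map_add' := fun _ _ => rfl }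
    (fun _ _ h x => h (π x))
    (fun a b h => by
      obtain ⟨k, hk, h1, h2⟩ := (seqDense_finiteValued ι).exists_between h
      have hc : CompactlyBelow (⟨fun x => k (π x), lowerSemicontinuous_of_dependsOn (hdep k)⟩ :
          Lsc (ℕ → Bool)) _ := compact_of_locallyConstant ⟨⟨n, hdep k⟩, fun x => hk (π x)⟩
      exact (hc.trans_le fun x => h2 (π x)).le_trans fun x => h1 (π x))
    (fun _ _ _ hs => isLUB_lsc_iff.2 fun x => isLUB_range_pi_iff.1 hs (π x))

/-- A compatible separating family of surjections from the Cantor set presents `Lsc(2^ℕ, ℕ∞)` as a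
limit. -/
theorem exists_isCuLimit_cantorLsc {F : ℕ ⥤ CuSem} {r : ℕ → ℕ}
    (e : ∀ i, F.obj i ≃+o (Fin (r i) → ℕ∞)) (π : ∀ i, (ℕ → Bool) → Fin (r i))
    (hsurj : ∀ i, Function.Surjective (π i)) (hdep : ∀ i, ∃ n, DependsOn (π i) (Set.Iio n))
    (hcomp : ∀ i j (h : i ≤ j) (a : F.obj i) x, e j (F.map (homOfLE h) a) (π j x) = e i a (π i x))
    (hsep : ∀ n, ∃ i, ∀ x y, π i x = π i y → ∀ k < n, x k = y k) :
    ∃ ι : F ⟶ (Functor.const ℕ).obj cantorLsc, IsCuLimit F cantorLsc ι := by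
  choose n hn using hdep
  let ι : F ⟶ (Functor.const ℕ).obj cantorLsc :=
    { app := fun i => ofEquiv (T := finPow (Fin (r i))) (e i) ≫ pullLsc (π i) (hn i)
      naturality := fun i j f => DFunLike.ext (F := CuMorphism (F.obj i) cantorLsc) _ _ fun a =>
        Subtype.ext (funext fun x => hcomp i j f.le a x) }
  refine ⟨ι, isCuLimit_of_dense ?_ (fun i => seqDense_compact_of_equiv (e i)) fun g => ?_⟩
  · intro i a b h
    rw [← map_le_map_iff (e i)]
    intro k
    obtain ⟨x, rfl⟩ := hsurj i k
    exact h x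
  · obtain ⟨z, hz, hzK, hs⟩ := exists_locallyConstant_approx g
    refine ⟨z, hz, fun m => ?_, hs⟩
    -- The fibres of `π i` determine the first `m` coordinates, so `z m` factors through `π i`; `b`
    -- is the factor.
    obtain ⟨i, hi⟩ := hsep m
    let b : Fin (r i) → ℕ∞ := fun k => (z m).1 (Function.surjInv (hsurj i) k)
    refine ⟨i, (e i).symm b, compactlyBelow_map_equiv (e i).toOrderIso.symm
      (compact_of_finiteValued fun k => (hzK m).2 _), Subtype.ext (funext fun x => ?_)⟩
    have h1 : e i ((e i).symm b) (π i x) = (z m).1 x := by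
      rw [OrderAddMonoidIso.apply_symm_apply]
      exact (hzK m).1 fun k hk => hi _ _ (Function.surjInv_eq (hsurj i) (π i x)) k hk
    exact h1

/-! ### Surjections from the Cantor set -/

/-- A surjection onto `Z` can be lifted, up to a factor `D` that surjects onto `Z`, along any
surjection `Z → C`. -/
theorem exists_lift_surjective {C D Z : Type*} {q : Z → C} (hq : Function.Surjective q) {u : D → Z}
    (hu : Function.Surjective u) :
    ∃ t : C × D → Z, Function.Surjective t ∧ ∀ c d, q (t (c, d)) = c := by
  classical
  -- The `D`-coordinate proposes a point, accepted if it lies over `c`; otherwise a fixed preimage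
  -- of `c` is used.
  refine ⟨fun p => if q (u p.2) = p.1 then u p.2 else Function.surjInv hq p.1, fun z => ?_, ?_⟩
  · obtain ⟨d, rfl⟩ := hu z
    exact ⟨(q (u d), d), if_pos rfl⟩
  · intro c d
    dsimp only
    split_ifs with h
    · exact h
    · exact Function.surjInv_eq hq c

/-- One-hot coding embeds `Z` into bit strings, and a left inverse is onto. -/
theorem exists_surjective_bits (Z : Type*) [Finite Z] [Nonempty Z] :
    ∃ (N : ℕ) (u : (Fin N → Bool) → Z), Function.Surjective u := by
  obtain ⟨N, ⟨e⟩⟩ := Finite.exists_equiv_fin Z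
  have hinj : Function.Injective fun (z : Z) (k : Fin N) => decide (e z = k) := by
    intro z w h
    have := congrFun h (e z)
    simp only [decide_true, eq_comm (a := true), decide_eq_true_eq] at this
    exact (e.injective this).symm
  exact ⟨N, Function.invFun _, Function.invFun_surjective hinj⟩

/-! ### Fraïssé sequences and back-and-forth -/

/-- The sequence with terms `Fin n → Bool` and restriction maps is a Fraïssé sequence. -/
theorem exists_isFraisseSequence : ∃ F : ℕ ⥤ CuSem, cantorCategory.IsFraisseSequence F := by
  let res : ∀ {i j : ℕ}, i ≤ j → (Fin j → Bool) → Fin i → Bool := fun h c k => c (Fin.castLE h k)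
  have hres : ∀ {i j : ℕ} (h : i ≤ j), Function.Surjective (res h) := fun {i j} h c =>
    ⟨fun k => if hk : k.1 < i then c ⟨k, hk⟩ else false, funext fun k => by simp [res]⟩
  let F : ℕ ⥤ CuSem :=
    { obj := fun n => finPow (Fin n → Bool)
      map := fun f => pull (res f.le)
      map_id := fun _ => rfl
      map_comp := fun _ _ => rfl }
  refine ⟨F, ⟨fun i => isSimplicial_finPow _, fun i j h => cantorCategory_pull (hres h)⟩,
    fun i => (isSimplicial_finPow _).isCountablyBased, fun i E C α hα => ?_⟩
  obtain ⟨s, hs, ⟨e⟩⟩ := hα.2.1.exists_equiv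
  obtain ⟨q, hq, hαq⟩ := exists_dual (S := finPow (Fin i → Bool))
    (OrderAddMonoidIso.refl ((Fin i → Bool) → ℕ∞)) e hα
  obtain ⟨N, u, hu⟩ := exists_surjective_bits (Fin s)
  obtain ⟨t, ht, hqt⟩ := exists_lift_surjective hq hu
  -- The first `i` bits fix the image under `q`; the `N` new bits range over the fibres, which makes
  -- `g` surjective.
  let g : (Fin (i + N) → Bool) → Fin s := fun c =>
    t (res (Nat.le_add_right i N) c, fun k => c (Fin.natAdd i k))
  have hg : Function.Surjective g := by
    intro z
    obtain ⟨⟨c, d⟩, rfl⟩ := ht z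
    refine ⟨Fin.append c d, congrArg t (Prod.ext (funext fun k => ?_) (funext fun k => ?_))⟩
    · exact Fin.append_left c d k
    · exact Fin.append_right c d k
  refine ⟨i + N, Nat.le_add_right i N, ofEquiv (T := finPow (Fin s)) e ≫ pull g,
    cantorCategory.comp_mem (cantorCategory_ofEquiv hα.2.1 _) (cantorCategory_pull hg),
    compareOn_of_eq _ ?_⟩
  refine DFunLike.ext (F := CuMorphism (finPow (Fin i → Bool)) (finPow (Fin (i + N) → Bool))) _ _
    fun a => funext fun c => ?_
  exact (hαq a (g c)).trans (congrArg (a : (Fin i → Bool) → ℕ∞) (hqt _ _))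

/-- The back-and-forth construction: an inverse sequence of finite sets with the extension property
is the sequence of quotients of the Cantor set. -/
theorem exists_cantor_surjections (Y : ℕ → Type) [∀ i, Finite (Y i)] [∀ i, Nonempty (Y i)]
    (p : ∀ i j, i ≤ j → Y j → Y i) (hp : ∀ i j h, Function.Surjective (p i j h))
    (hpp : ∀ i j k hij hjk y, p i j hij (p j k hjk y) = p i k (hij.trans hjk) y)
    (hext : ∀ i m (q : (Fin m → Bool) → Y i), Function.Surjective q →
      ∃ j, ∃ h : i < j, ∃ g : Y j → (Fin m → Bool), Function.Surjective g ∧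
        ∀ y, q (g y) = p i j h.le y) :
    ∃ π : ∀ i, (ℕ → Bool) → Y i, (∀ i, Function.Surjective (π i)) ∧
      (∀ i, ∃ n, DependsOn (π i) (Set.Iio n)) ∧
      (∀ i j h x, p i j h (π j x) = π i x) ∧
      ∀ n, ∃ i, ∀ x y, π i x = π i y → ∀ k < n, x k = y k := by
  let St := Σ i, {P : (ℕ → Bool) → Y i // Function.Surjective P ∧ ∃ n, DependsOn P (Set.Iio n)}
  -- Going back, `P` factors as `q` through its first `m` bits, and `hext` lifts the projection to
  -- `Y i` through `q`, giving `g`. Going forth, the first `m` bits lift through `g`, with `N`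
  -- further bits securing surjectivity. Since `g ∘ P'` returns the first `m ≥ n` bits, `P'`
  -- separates them.
  have hstep : ∀ (n : ℕ) (s : St), ∃ s' : St, ∃ h : s.1 < s'.1,
      (∀ x, p s.1 s'.1 h.le (s'.2.1 x) = s.2.1 x) ∧
      ∀ x y, s'.2.1 x = s'.2.1 y → ∀ k < n, x k = y k := by
    rintro n ⟨i, P, hP, m₀, hm₀⟩
    obtain ⟨m, hm, hnm⟩ : ∃ m, DependsOn P (Set.Iio m) ∧ n ≤ m :=
      ⟨max m₀ n, fun _ _ h => hm₀ fun k hk => h k (lt_of_lt_of_le (Set.mem_Iio.1 hk) (le_max_left m₀ n)), le_max_right _ _⟩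
    let q : (Fin m → Bool) → Y i := fun c => P fun k => if hk : k < m then c ⟨k, hk⟩ else false
    have hqP : ∀ x : ℕ → Bool, q (fun k => x k) = P x := fun x => hm fun k hk => dif_pos hk
    obtain ⟨j, hij, g, hg, hqg⟩ := hext i m q fun y =>
      let ⟨x, hx⟩ := hP y
      ⟨fun k => x k, (hqP x).trans hx⟩
    obtain ⟨N, u, hu⟩ := exists_surjective_bits (Y j)
    obtain ⟨t, ht, hgt⟩ := exists_lift_surjective hg hu
    let P' : (ℕ → Bool) → Y j := fun x => t (fun k => x k, fun k => x (m + k))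
    refine ⟨⟨j, P', ?_, m + N, ?_⟩, hij, ?_, ?_⟩
    · intro y
      obtain ⟨⟨c, d⟩, rfl⟩ := ht y
      refine ⟨fun k => if hk : k < m then c ⟨k, hk⟩ else
        if hk' : k - m < N then d ⟨k - m, hk'⟩ else false, congrArg t (Prod.ext ?_ ?_)⟩
      · funext k; simp
      · funext k; simp
    · intro x y h
      refine congrArg t (Prod.ext (funext fun k => h _ ?_) (funext fun k => h _ ?_))
      · simp only [Set.mem_Iio]; omega
      · simp
    · intro x
      exact (hqg _).symm.trans ((congrArg q (hgt _ _)).trans (hqP x))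
    · intro x y h k hk
      have h1 := congrArg g h
      simp only [P', hgt] at h1
      exact congrFun h1 ⟨k, hk.trans_le hnm⟩
  obtain ⟨N, u, hu⟩ := exists_surjective_bits (Y 0)
  let s₀ : St := ⟨0, fun x => u fun k => x k, fun y => by
    obtain ⟨c, rfl⟩ := hu y
    exact ⟨fun k => if hk : k < N then c ⟨k, hk⟩ else false, congrArg u (funext fun k => by simp)⟩,
    N, fun x y h => congrArg u (funext fun k => h _ k.2)⟩
  choose next hlt hnext hsep using hstep
  let s : ℕ → St := fun n => Nat.rec s₀ (fun n t => next n t) n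
  have hmono : StrictMono fun n => (s n).1 := strictMono_nat_of_lt_succ fun n => hlt n (s n)
  have hcompat : ∀ m n (h : m ≤ n) x,
      p _ _ (hmono.monotone h) ((s n).2.1 x) = (s m).2.1 x := by
    intro m n h
    induction n, h using Nat.le_induction with
    | base =>
      intro x
      -- The map `p i i` is idempotent and surjective, hence the identity.
      obtain ⟨y, hy⟩ := hp _ _ (le_refl (s m).1) ((s m).2.1 x)
      have h1 := hpp _ _ _ le_rfl le_rfl y
      rw [hy] at h1
      exact h1
    | succ n hmn ih =>
      intro x
      rw [← ih x, ← hnext n (s n) x]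
      exact (hpp _ _ _ (hmono.monotone hmn) (hlt n (s n)).le _).symm
  have hle : ∀ i, i ≤ (s i).1 := fun i => hmono.le_apply
  -- Strictly increasing stages give `i ≤ (s i).1`, so the constructed surjection can be projected
  -- down to `Y i`.
  let π : ∀ i, (ℕ → Bool) → Y i := fun i x => p i _ (hle i) ((s i).2.1 x)
  have hπ : ∀ i m (h : i ≤ m) x, p i _ ((hle i).trans (hmono.monotone h)) ((s m).2.1 x) = π i x :=
    fun i m h x => by
      simp only [π]
      rw [← hcompat i m h x]
      exact (hpp _ _ _ (hle i) (hmono.monotone h) _).symm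
  refine ⟨π, fun i => (hp _ _ _).comp (s i).2.2.1, fun i => ?_, fun i j h x => ?_, fun n => ?_⟩
  · obtain ⟨n, hn⟩ := (s i).2.2.2
    exact ⟨n, fun x y h => congrArg (p i _ (hle i)) (hn h)⟩
  · exact (hpp _ _ _ _ _ _).trans (hπ i j h x)
  · refine ⟨(s (n + 1)).1, fun x y h => hsep n (s n) x y ?_⟩
    have h1 : ∀ x, π (s (n + 1)).1 x = (s (n + 1)).2.1 x := fun x =>
      hcompat (n + 1) (s (n + 1)).1 (hle (n + 1)) x
    rw [h1, h1] at h
    exact h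

/-- Surjections from bit strings to the index set of `F.obj i` are dual to morphisms into powers
indexed by bit strings. The Fraïssé property thus becomes the extension property required by
`exists_cantor_surjections`. -/
theorem exists_isCuLimit_of_isFraisseSequence {F : ℕ ⥤ CuSem}
    (hF : cantorCategory.IsFraisseSequence F) :
    ∃ ι : F ⟶ (Functor.const ℕ).obj cantorLsc, IsCuLimit F cantorLsc ι := by
  classical
  obtain ⟨hseq, -, hext⟩ := hF
  choose r hr e using fun i => IsSimplicial.exists_equiv (hseq.1 i)
  have e := fun i => (e i).some
  choose p hp hpe using fun i j h => exists_dual (e i) (e j) (hseq.2 i j h)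
  have hpp : ∀ i j k hij hjk y, p i j hij (p j k hjk y) = p i k (hij.trans hjk) y := by
    intro i j k hij hjk y
    refine dual_unique fun a => ?_
    obtain ⟨b, rfl⟩ := EquivLike.surjective (e i) a
    rw [← hpe, ← hpe, ← hpe]
    have : F.map (homOfLE (hij.trans hjk)) = F.map (homOfLE hij) ≫ F.map (homOfLE hjk) :=
      F.map_comp (homOfLE hij) (homOfLE hjk)
    rw [this]
    rfl
  obtain ⟨π, hsurj, hdep, hcomp, hsep⟩ := exists_cantor_surjections (fun i => Fin (r i)) p hp hpp (by
    intro i m q hq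
    let α : F.obj i ⟶ finPow (Fin m → Bool) := ofEquiv (T := finPow (Fin (r i))) (e i) ≫ pull q
    have hα : cantorCategory.Hom α := cantorCategory.comp_mem
      (cantorCategory_ofEquiv (hseq.1 i) _) (cantorCategory_pull hq)
    -- Testing on the generators suffices: they are compact, so near equality there is equality, and
    -- they determine a morphism.
    obtain ⟨j, hij, β, hβ, hE⟩ := hext i
      (Finset.univ.image fun k => (e i).symm (Pi.single k 1)) _ α hα
    obtain ⟨g, hg, hge⟩ := exists_dual (S := finPow (Fin m → Bool))
      (OrderAddMonoidIso.refl ((Fin m → Bool) → ℕ∞)) (e j) hβ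
    have heq : α ≫ β = F.map (homOfLE hij) := ext_of_single (e i) fun k =>
      hE.eq_of_compact (Finset.mem_image_of_mem _ (Finset.mem_univ k))
        (compactlyBelow_map_equiv (e i).toOrderIso.symm (compact_of_finiteValued fun l => by
          by_cases h : l = k
          · subst h; simp
          · simp [h]))
    have hqg : ∀ y, q (g y) = p i j hij y := by
      refine fun y => dual_unique fun a => ?_
      obtain ⟨b, rfl⟩ := EquivLike.surjective (e i) a
      rw [← hpe, ← heq]
      exact (hge (α b) y).symm
    -- The Fraïssé property only gives `i ≤ j`; one more step makes the inequality strict.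
    refine ⟨j + 1, Nat.lt_succ_of_le hij, g ∘ p j (j + 1) j.le_succ, hg.comp (hp _ _ _), fun y => ?_⟩
    exact (hqg _).trans (hpp _ _ _ _ _ _))
  refine exists_isCuLimit_cantorLsc e π hsurj hdep (fun i j h a x => ?_) hsep
  rw [hpe, hcomp]

end CuFraisse

theorem mainTheorem10 :
    CuFraisse.cantorCategory.IsFraisse ∧
      ∃ _ : CuFraisse.IsCuSemigroup (CuFraisse.Lsc (ℕ → Bool)),
        CuFraisse.cantorCategory.IsFraisseLimit
          { carrier := CuFraisse.Lsc (ℕ → Bool) } := by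
  refine ⟨⟨CuFraisse.cantorCategory_jep, CuFraisse.cantorCategory_nap,
    CuFraisse.cantorCategory_sep⟩, inferInstance, CuFraisse.exists_isFraisseSequence,
    fun F hF => ?_⟩
  obtain ⟨ι, hι⟩ := CuFraisse.exists_isCuLimit_of_isFraisseSequence hF
  exact ⟨ι, hι.completion_isLimit hF.1, hι⟩
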